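/- For $0<\theta\le 2\pi$ let $C_\theta$ be the hyperbolic cone of total angle $\theta$: the set of pairs $(\rho,\alpha)$ with $\rho\ge 0$, $\alpha\in\mathbb{R}/\theta\mathbb{Z}$, with all pairs $(0,\alpha)$ identified to one point (the apex), with the distance given by $$\cosh d\big((\rho,\alpha),(\sigma,\beta)\big)=\cosh\rho\cosh\sigma-\sinh\rho\,\sinh\sigma\,\cos|\alpha-\beta|,$$ where $|\alpha-\beta|\in[0,\theta/2]$ is the distance in the circle $\mathbb{R}/\theta\mathbb{Z}$; thus $C_{2\pi}$ is the hyperbolic plane of curvature $-1$. Let $\mathcal{S}$ be a closed (compact, without boundary) connected surface with a hyperbolic polyhedral metric $h$, that is, a distance $\mathrm{d}_h$ inducing the topology of $\mathcal{S}$ such that $\mathrm{d}_h(x,y)$ is always the infimum of the lengths of the paths from $x$ to $y$, and such that every point $p\in\mathcal{S}$ is the centre of a ball of positive radius which is isometric to the ball of the same radius about the apex of a cone $C_\theta$, $0<\theta=\theta(p)\le 2\pi$, with $p$ corresponding to the apex. (The points with $\theta(p)<2\pi$, the conic singularities, form a discrete set; away from them $h$ is hyperbolic.) Every such isometry gives a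 polar coordinate chart at $p$, in which the point corresponding to $(\rho,\alpha)\in C_\theta$ has Euclidean polar coordinates $(\rho,\tfrac{2\pi}{\theta}\alpha)$. Then $\mathcal{S}$ carries a $C^\infty$ structure in which all these polar coordinate charts are smooth and, for this structure, there is a sequence $(h_n)_{n\in\mathbb{N}}$ of $C^\infty$ Riemannian metrics on $\mathcal{S}$, each of sectional (Gaussian) curvature strictly greater than $-1$ at every point, which converges to $h$ in the following sense: for every $\varepsilon>0$ there is $N\in\mathbb{N}$ such that for all $n\ge N$ and all $x,y\in\mathcal{S}$ $$|\mathrm{d}_{h_n}(x,y)-\mathrm{d}_h(x,y)|<\varepsilon,$$ where $\mathrm{d}_{h_n}$ is the Riemannian distance of $h_n$. -/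

import Mathlib

open scoped Manifold ContDiff Bundle

noncomputable section

/-- The Euclidean plane, the model space of smooth surfaces. -/
abbrev Plane : Type := EuclideanSpace ℝ (Fin 2)

/-! ### Hyperbolic polyhedral metrics -/

/-- The distance of the hyperbolic cone of total angle `θ ≤ 2π`. A point of the cone at distance `ρ`
from the apex and with angular coordinate `α ∈ ℝ / θℤ` is represented by the point of the plane
with polar coordinates `(ρ, (2π / θ) α)`; the apex is `0`. The angular distance on the cone of two
points `z`, `w` is thus `(θ / 2π) * ∠(z, w)`, which is at most `θ / 2 ≤ π`, and their distance is
given by the hyperbolic law of cosines. For `θ = 2π` this is the hyperbolic plane of curvature `-1`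
in geodesic polar coordinates. -/
def coneDist (θ : ℝ) (z w : Plane) : ℝ :=
  Real.arcosh (Real.cosh ‖z‖ * Real.cosh ‖w‖ -
    Real.sinh ‖z‖ * Real.sinh ‖w‖ *
      Real.cos (θ / (2 * Real.pi) * InnerProductGeometry.angle z w))

/-- `φ` is an isometry of the ball of radius `r` about `p` onto the ball of radius `r` about the
apex of the hyperbolic cone of total angle `θ`, taking `p` to the apex. -/
structure IsConeChart {S : Type*} [MetricSpace S] (θ : ℝ) (p : S) (r : ℝ)
    (φ : OpenPartialHomeomorph S Plane) : Prop where
  source_eq : φ.source = Metric.ball p r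
  target_eq : φ.target = Metric.ball 0 r
  map_center : φ p = 0
  dist_eq : ∀ x ∈ Metric.ball p r, ∀ y ∈ Metric.ball p r, dist x y = coneDist θ (φ x) (φ y)

/-- The distance of `S` is a hyperbolic polyhedral metric: it is a length metric, and every point
has a ball isometric to a ball about the apex of a hyperbolic cone of total angle `θ ∈ (0, 2π]`.
Points with `θ = 2π` are the regular ones, near which the metric is hyperbolic; points with
`θ < 2π` are the conic singularities. All points of a cone but its apex are regular, so that
the conic singularities form a discrete set, and `S` is a topological surface without boundary. -/
structure IsHyperbolicPolyhedral (S : Type*) [MetricSpace S] : Prop where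
  exists_path : ∀ x y : S, ∀ ε : ℝ, 0 < ε →
    ∃ γ : Path x y, eVariationOn γ Set.univ ≤ ENNReal.ofReal (dist x y + ε)
  exists_coneChart : ∀ p : S, ∃ θ : ℝ, 0 < θ ∧ θ ≤ 2 * Real.pi ∧ ∃ r : ℝ, 0 < r ∧
    ∃ φ : OpenPartialHomeomorph S Plane, IsConeChart θ p r φ

/-! ### Gaussian curvature in coordinates -/

/-- The partial derivative `∂f / ∂xᵢ` at `u`. -/
def partialDeriv (i : Fin 2) (f : Plane → ℝ) (u : Plane) : ℝ :=
  fderiv ℝ f u (EuclideanSpace.single i 1)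

/-- The Christoffel symbol `Γᵏᵢⱼ` of the metric with coefficient matrix `G`. -/
def christoffel (G : Plane → Matrix (Fin 2) (Fin 2) ℝ) (k i j : Fin 2) (u : Plane) : ℝ :=
  1 / 2 * ∑ l, (G u)⁻¹ k l *
    (partialDeriv i (fun v => G v j l) u + partialDeriv j (fun v => G v i l) u -
      partialDeriv l (fun v => G v i j) u)

/-- The component `Rˡₖᵢⱼ` of the curvature tensor of the metric with coefficient matrix `G`:
`R(∂ᵢ, ∂ⱼ)∂ₖ = ∑ₗ Rˡₖᵢⱼ ∂ₗ`, where `R(X, Y)Z = ∇_X ∇_Y Z - ∇_Y ∇_X Z - ∇_[X,Y] Z`. -/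
def riemannCoeff (G : Plane → Matrix (Fin 2) (Fin 2) ℝ) (l k i j : Fin 2) (u : Plane) : ℝ :=
  partialDeriv i (christoffel G l j k) u - partialDeriv j (christoffel G l i k) u +
    ∑ m, (christoffel G l i m u * christoffel G m j k u -
      christoffel G l j m u * christoffel G m i k u)

/-- The sectional curvature `⟨R(∂₀, ∂₁)∂₁, ∂₀⟩ / det G` of the metric with coefficient matrix
`G` on a domain of the plane. -/
def planeCurvature (G : Plane → Matrix (Fin 2) (Fin 2) ℝ) (u : Plane) : ℝ :=
  (∑ l, riemannCoeff G l 1 0 1 u * G u l 0) / (G u).det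

/-! ### Smooth Riemannian metrics on a surface -/

/-- A `C^∞` Riemannian metric on the smooth surface `S`. -/
abbrev SmoothMetric (S : Type*) [TopologicalSpace S] [ChartedSpace Plane S]
    [IsManifold 𝓘(ℝ, Plane) ∞ S] : Type _ :=
  Bundle.ContMDiffRiemannianMetric 𝓘(ℝ, Plane) ∞ Plane
    (fun x : S => TangentSpace 𝓘(ℝ, Plane) x)

namespace SmoothMetric

variable {S : Type*} [TopologicalSpace S] [ChartedSpace Plane S] [IsManifold 𝓘(ℝ, Plane) ∞ S]

/-- The coefficients `gᵢⱼ = g(∂ᵢ, ∂ⱼ)` of `g` in the chart `φ`, as functions on the image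
of `φ`. -/
def coeff (g : SmoothMetric S) (φ : OpenPartialHomeomorph S Plane) (u : Plane) :
    Matrix (Fin 2) (Fin 2) ℝ :=
  Matrix.of fun i j => g.inner (φ.symm u)
    (mfderiv 𝓘(ℝ, Plane) 𝓘(ℝ, Plane) φ.symm u (EuclideanSpace.single i (1 : ℝ) : Plane))
    (mfderiv 𝓘(ℝ, Plane) 𝓘(ℝ, Plane) φ.symm u (EuclideanSpace.single j (1 : ℝ) : Plane))

/-- The sectional (Gaussian) curvature of `g` at `x`, computed in the preferred chart at `x`. -/
def curvature (g : SmoothMetric S) (x : S) : ℝ :=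
  planeCurvature (coeff g (chartAt Plane x)) (chartAt Plane x x)

/-- The Riemannian distance of `g`: the infimum of the `g`-lengths of the `C^1` paths between the
two points (it is finite on a connected surface). -/
def distance (g : SmoothMetric S) (x y : S) : ℝ :=
  letI : Bundle.RiemannianBundle (fun z : S => TangentSpace 𝓘(ℝ, Plane) z) :=
    ⟨g.toRiemannianMetric⟩
  (Manifold.riemannianEDist 𝓘(ℝ, Plane) x y).toReal

end SmoothMetric

end

/-!
A hyperbolic cone of angle `2πa`, `a ≤ 1`, is smoothed near its apex by a rotationally symmetric
metric of curvature at least `-1`; since this can be done in arbitrarily small balls, the distances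
converge.

All computations are made in hyperboloid coordinates `X`, in which the radius `ρ` of geodesic polar
coordinates is replaced by `sinh ρ`; both coordinates are related by a diffeomorphism of the plane
(`contDiff_sinhMap`, `contDiff_arsinhMap`). In these coordinates the cone distance has the
infinitesimal form `coneForm`, that is `a² |dX|² + (1 / (1 + s) - a²) ⟨X, dX⟩² / s`, where
`s = |X|²`, as follows from the law of cosines (`hypDist_sq_sub_coneForm_isLittleO`).

*Smooth structure.* Away from the apex a cone develops isometrically and smoothly into the
hyperbolic plane (`exists_development`). An isometry between two cones fixing the apices exists near
them only if the angles are equal, and is then linear (`exists_linear_of_hypDist_eq`). Hence all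
transition maps between cone charts are smooth (`contDiffAt_transition`), and they respect
`coneForm`, since they are isometries of the distance (`coneForm_transition`). By compactness a
chart can be chosen around each point so that distinct charts overlap only at a positive distance
from the singularities (`ConeAtlas`).

*Smoothed metrics.* The metric `a² |dX|² + B(s) ⟨X, dX⟩²` has Gaussian curvature `q' / q²`, where
`q = a² + s B` (`planeCurvature_radialMatrix`). For the cone, `1 / q = 1 + s`. Take instead
`1 / q = 1 + s + (1 / a² - 1) η(s)`, where `η` is a nonincreasing cutoff function that is `1` near
`0` and vanishes for `s ≥ sinh² δ`. Then `B` is smooth at the apex, the metric is unchanged at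
distance at least `δ` from it, and the curvature `-(1 / q)'` is at least `-1`. Multiplying the
metric by a constant `c > 1` makes the inequality strict (`capBilin`,
`neg_one_lt_planeCurvature_capBilin`). These metrics agree on overlaps and define a smooth metric on
the surface (`ConeAtlas.smoothMetric`).

*Distances.* The smoothed metric is at most `c` times the original one, so that its distance is
locally, and by subdividing nearly shortest paths globally, at most about `√c` times the original
distance (`ConeAtlas.eDistance_smoothMetric_le`). For the converse, the distance from `x₀` is
modified to a function that is constant on the `δ`-balls about the singularities, where the
smoothed metric may be much smaller than the original one, and `k`-Lipschitz with `k` close to `1`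
(`ConeAtlas.flatDist`). Integrating its variation along a curve bounds the original distance by `k`
times the length of the curve plus `2δ` (`ConeAtlas.dist_le_mul_of_eDistance_lt`).
-/

noncomputable section

open Asymptotics Filter Topology

/-! ### Curvature of rotationally symmetric metrics -/

/-- The coefficient matrix of the rotationally symmetric metric `A |dX|² + B(|X|²) ⟨X, dX⟩²`. -/
def radialMatrix (A : ℝ) (B : ℝ → ℝ) (u : Plane) : Matrix (Fin 2) (Fin 2) ℝ :=
  Matrix.of fun i j => A * (if i = j then 1 else 0) + B (‖u‖ ^ 2) * (u i * u j)

lemma plane_norm_sq (u : Plane) : ‖u‖ ^ 2 = u 0 ^ 2 + u 1 ^ 2 := by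
  rw [EuclideanSpace.real_norm_sq_eq, Fin.sum_univ_two]

lemma Filter.EventuallyEq.partialDeriv_eq {f g : Plane → ℝ} {u : Plane} (h : f =ᶠ[nhds u] g)
    (i : Fin 2) : partialDeriv i f u = partialDeriv i g u := by
  simp only [partialDeriv, h.fderiv_eq]

lemma HasFDerivAt.partialDeriv_eq {f : Plane → ℝ} {f' : Plane →L[ℝ] ℝ} {u : Plane}
    (h : HasFDerivAt f f' u) (i : Fin 2) :
    partialDeriv i f u = f' (EuclideanSpace.single i 1) := by
  rw [partialDeriv, h.fderiv]

lemma hasFDerivAt_coord (k : Fin 2) (u : Plane) :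
    HasFDerivAt (fun v : Plane => v k) (EuclideanSpace.proj k : Plane →L[ℝ] ℝ) u :=
  (EuclideanSpace.proj k : Plane →L[ℝ] ℝ).hasFDerivAt

lemma HasDerivAt.hasFDerivAt_comp_norm_sq {f : ℝ → ℝ} {f' : ℝ} {u : Plane}
    (h : HasDerivAt f f' (‖u‖ ^ 2)) :
    HasFDerivAt (fun v : Plane => f (‖v‖ ^ 2)) (f' • ((2 * u 0) • (EuclideanSpace.proj 0 :
      Plane →L[ℝ] ℝ) + (2 * u 1) • (EuclideanSpace.proj 1 : Plane →L[ℝ] ℝ))) u := by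
  have h1 : HasFDerivAt (fun v : Plane => ‖v‖ ^ 2) ((2 * u 0) • (EuclideanSpace.proj 0 :
      Plane →L[ℝ] ℝ) + (2 * u 1) • (EuclideanSpace.proj 1 : Plane →L[ℝ] ℝ)) u := by
    simp only [plane_norm_sq]
    refine (((hasFDerivAt_coord 0 u).pow 2).add ((hasFDerivAt_coord 1 u).pow 2)).congr_fderiv ?_
    simp
  exact h.comp_hasFDerivAt u h1

lemma partialDeriv_radialMatrix {A : ℝ} {B : ℝ → ℝ} {u : Plane} {B' : ℝ}
    (hB : HasDerivAt B B' (‖u‖ ^ 2)) (l i j : Fin 2) :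
    partialDeriv l (fun v => radialMatrix A B v i j) u =
      2 * B' * u l * u i * u j + B (‖u‖ ^ 2) *
        ((if l = i then 1 else 0) * u j + (if l = j then 1 else 0) * u i) := by
  have h := (((hB.hasFDerivAt_comp_norm_sq).mul ((hasFDerivAt_coord i u).mul
    (hasFDerivAt_coord j u))).const_add (A * (if i = j then 1 else 0)))
  refine (HasFDerivAt.partialDeriv_eq h l).trans ?_
  fin_cases l <;> fin_cases i <;> fin_cases j <;> simp <;> ring

lemma radialMatrix_det (A : ℝ) (B : ℝ → ℝ) (u : Plane) :
    (radialMatrix A B u).det = A * (A + ‖u‖ ^ 2 * B (‖u‖ ^ 2)) := by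
  rw [Matrix.det_fin_two, plane_norm_sq]
  simp [radialMatrix, plane_norm_sq]
  ring

lemma christoffel_radialMatrix {A : ℝ} {B : ℝ → ℝ} {u : Plane} {B' : ℝ}
    (hB : HasDerivAt B B' (‖u‖ ^ 2)) (hA : A ≠ 0) (hq : A + ‖u‖ ^ 2 * B (‖u‖ ^ 2) ≠ 0)
    (k i j : Fin 2) :
    christoffel (radialMatrix A B) k i j u =
      u k * ((B (‖u‖ ^ 2) * (if i = j then 1 else 0) + B' * (u i * u j)) /
        (A + ‖u‖ ^ 2 * B (‖u‖ ^ 2))) := by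
  have hdet := radialMatrix_det A B u
  have hinv : (radialMatrix A B u)⁻¹ = (A * (A + ‖u‖ ^ 2 * B (‖u‖ ^ 2)))⁻¹ •
      (radialMatrix A B u).adjugate := by
    rw [Matrix.inv_def, hdet, Ring.inverse_eq_inv']
  rw [christoffel, hinv, Matrix.adjugate_fin_two]
  simp only [partialDeriv_radialMatrix hB, Fin.sum_univ_two]
  have hs := plane_norm_sq u
  set b := B (‖u‖ ^ 2) with hb
  simp only [radialMatrix, Matrix.of_apply, ← hb]
  generalize ‖u‖ ^ 2 = s at *
  subst hs
  fin_cases k <;> fin_cases i <;> fin_cases j <;> simp <;> field_simp <;> ring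

/-- The Gaussian curvature of `A |dX|² + B(|X|²) ⟨X, dX⟩²` is `q' / q²`, where
`q(s) = A + s B(s)` is the squared length of the Euclidean unit vector in radial direction at a
point with `|X|² = s`. -/
theorem planeCurvature_radialMatrix {A : ℝ} {B : ℝ → ℝ} (hB : ∀ s, 0 ≤ s → ContDiffAt ℝ ∞ B s)
    {G : Plane → Matrix (Fin 2) (Fin 2) ℝ} {u : Plane} (hG : G =ᶠ[nhds u] radialMatrix A B)
    (hA : 0 < A) (hq : 0 < A + ‖u‖ ^ 2 * B (‖u‖ ^ 2)) :
    planeCurvature G u = (B (‖u‖ ^ 2) + ‖u‖ ^ 2 * deriv B (‖u‖ ^ 2)) /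
      (A + ‖u‖ ^ 2 * B (‖u‖ ^ 2)) ^ 2 := by
  have hBd : ∀ v : Plane, DifferentiableAt ℝ B (‖v‖ ^ 2) := fun v =>
    (hB _ (sq_nonneg _)).differentiableAt (by simp)
  have hBd' : DifferentiableAt ℝ (deriv B) (‖u‖ ^ 2) := by
    have h := ((hB _ (sq_nonneg ‖u‖)).fderiv_right (m := 1) (by norm_cast)).clm_apply
      (contDiffAt_const (c := (1 : ℝ)))
    exact h.differentiableAt one_ne_zero
  have hcont : ContinuousAt (fun v : Plane => A + ‖v‖ ^ 2 * B (‖v‖ ^ 2)) u := by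
    have h1 : ContinuousAt (fun v : Plane => ‖v‖ ^ 2) u := (continuous_norm.pow 2).continuousAt
    exact continuousAt_const.add (h1.mul (ContinuousAt.comp (g := B) (hBd u).continuousAt h1))
  have hpos : ∀ᶠ v in nhds u, 0 < A + ‖v‖ ^ 2 * B (‖v‖ ^ 2) :=
    hcont.eventually (lt_mem_nhds hq)
  -- the Christoffel symbols in a neighbourhood, as they are to be differentiated once more
  have hΓ : ∀ k i j, christoffel G k i j =ᶠ[nhds u] fun v => v k *
      ((B (‖v‖ ^ 2) * (if i = j then 1 else 0) + deriv B (‖v‖ ^ 2) * (v i * v j)) /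
        (A + ‖v‖ ^ 2 * B (‖v‖ ^ 2))) := by
    intro k i j
    filter_upwards [hpos, hG.eventuallyEq_nhds] with v hv hGv
    rw [← christoffel_radialMatrix (hBd _).hasDerivAt hA.ne' hv.ne', christoffel, christoffel,
      hGv.eq_of_nhds]
    congr 1
    refine Finset.sum_congr rfl fun l _ => ?_
    have h1 : ∀ a b, (fun v => G v a b) =ᶠ[nhds v] fun v => radialMatrix A B v a b := fun a b =>
      hGv.mono fun w hw => by simp only [hw]
    rw [(h1 _ _).partialDeriv_eq, (h1 _ _).partialDeriv_eq, (h1 _ _).partialDeriv_eq]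
  have hdΓ : ∀ l k i j, partialDeriv l (christoffel G k i j) u =
      (if l = k then 1 else 0) * ((B (‖u‖ ^ 2) * (if i = j then 1 else 0) +
        deriv B (‖u‖ ^ 2) * (u i * u j)) / (A + ‖u‖ ^ 2 * B (‖u‖ ^ 2))) +
      u k * (((deriv B (‖u‖ ^ 2) * (2 * u l) * (if i = j then 1 else 0) +
        (deriv (deriv B) (‖u‖ ^ 2) * (2 * u l) * (u i * u j) + deriv B (‖u‖ ^ 2) *
          ((if l = i then 1 else 0) * u j + (if l = j then 1 else 0) * u i))) *
          (A + ‖u‖ ^ 2 * B (‖u‖ ^ 2)) -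
        (B (‖u‖ ^ 2) * (if i = j then 1 else 0) + deriv B (‖u‖ ^ 2) * (u i * u j)) *
          ((B (‖u‖ ^ 2) + ‖u‖ ^ 2 * deriv B (‖u‖ ^ 2)) * (2 * u l))) /
        (A + ‖u‖ ^ 2 * B (‖u‖ ^ 2)) ^ 2) := by
    intro l k i j
    have h1 := (hBd u).hasDerivAt.hasFDerivAt_comp_norm_sq
    have h2 := hBd'.hasDerivAt.hasFDerivAt_comp_norm_sq
    have h3 := (((hasDerivAt_id (‖u‖ ^ 2)).mul
      (hBd u).hasDerivAt).const_add A).hasFDerivAt_comp_norm_sq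
    have h4 := (h1.mul_const (if i = j then 1 else 0)).add
      (h2.mul ((hasFDerivAt_coord i u).mul (hasFDerivAt_coord j u)))
    have h5 := (hasDerivAt_inv hq.ne').comp_hasFDerivAt u h3
    have h6 := (hasFDerivAt_coord k u).mul (h4.mul h5)
    rw [(hΓ k i j).partialDeriv_eq]
    refine (HasFDerivAt.partialDeriv_eq h6 l).trans ?_
    have hq' := hq.ne'
    clear h1 h2 h3 h4 h5 h6 hΓ hpos
    simp only [Function.comp, id, Pi.mul_apply, Pi.add_apply]
    generalize A + ‖u‖ ^ 2 * B (‖u‖ ^ 2) = q at *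
    fin_cases l <;> fin_cases k <;> fin_cases i <;> fin_cases j <;> simp <;> field_simp <;> ring
  have hGu := hG.eq_of_nhds
  rw [planeCurvature, hGu, radialMatrix_det]
  simp only [Fin.sum_univ_two, riemannCoeff, hdΓ, fun k i j => (hΓ k i j).eq_of_nhds,
    radialMatrix, Matrix.of_apply]
  have hs := plane_norm_sq u
  generalize B (‖u‖ ^ 2) = b at *
  generalize deriv B (‖u‖ ^ 2) = b1 at *
  generalize deriv (deriv B) (‖u‖ ^ 2) = b2 at *
  generalize ‖u‖ ^ 2 = s at *
  subst hs
  have hq' := hq.ne'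
  clear hdΓ hΓ hpos
  generalize hq0 : A + (u 0 ^ 2 + u 1 ^ 2) * b = q at *
  simp
  field_simp
  rw [← hq0]
  ring

/-! ### From polar coordinates to hyperboloid coordinates -/

/-- The change from geodesic polar coordinates to hyperboloid coordinates, which replaces the
radius `ρ` by `sinh ρ`. -/
def sinhMap (u : Plane) : Plane := (Real.sinh ‖u‖ / ‖u‖) • u

/-- The change from hyperboloid coordinates to geodesic polar coordinates. -/
def arsinhMap (u : Plane) : Plane := (Real.arsinh ‖u‖ / ‖u‖) • u

lemma norm_div_norm_smul {f : ℝ → ℝ} (h0 : f 0 = 0) (hf : ∀ x, 0 ≤ x → 0 ≤ f x) (u : Plane) :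
    ‖(f ‖u‖ / ‖u‖) • u‖ = f ‖u‖ := by
  rcases eq_or_ne u 0 with rfl | hu
  · simp [h0]
  · have : ‖u‖ ≠ 0 := norm_ne_zero_iff.2 hu
    rw [norm_smul, Real.norm_of_nonneg (div_nonneg (hf _ (norm_nonneg _)) (norm_nonneg _))]
    field_simp

lemma norm_sinhMap (u : Plane) : ‖sinhMap u‖ = Real.sinh ‖u‖ :=
  norm_div_norm_smul Real.sinh_zero (fun _ => Real.sinh_nonneg_iff.2) u

lemma norm_arsinhMap (u : Plane) : ‖arsinhMap u‖ = Real.arsinh ‖u‖ :=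
  norm_div_norm_smul Real.arsinh_zero (fun _ => Real.arsinh_nonneg_iff.2) u

lemma sinhMap_zero : sinhMap 0 = 0 := by simp [sinhMap]

lemma arsinhMap_zero : arsinhMap 0 = 0 := by simp [arsinhMap]

lemma arsinhMap_sinhMap (u : Plane) : arsinhMap (sinhMap u) = u := by
  rcases eq_or_ne u 0 with rfl | hu
  · simp [arsinhMap, sinhMap]
  · have h1 : ‖u‖ ≠ 0 := norm_ne_zero_iff.2 hu
    have h2 : Real.sinh ‖u‖ ≠ 0 := by rwa [Ne, Real.sinh_eq_zero]
    rw [arsinhMap, norm_sinhMap, Real.arsinh_sinh, sinhMap, smul_smul]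
    rw [show ‖u‖ / Real.sinh ‖u‖ * (Real.sinh ‖u‖ / ‖u‖) = 1 by field_simp, one_smul]

lemma sinhMap_arsinhMap (u : Plane) : sinhMap (arsinhMap u) = u := by
  rcases eq_or_ne u 0 with rfl | hu
  · simp [arsinhMap, sinhMap]
  · have h1 : ‖u‖ ≠ 0 := norm_ne_zero_iff.2 hu
    have h2 : Real.arsinh ‖u‖ ≠ 0 := by rwa [Ne, Real.arsinh_eq_zero_iff]
    rw [sinhMap, norm_arsinhMap, Real.sinh_arsinh, arsinhMap, smul_smul]
    rw [show ‖u‖ / Real.arsinh ‖u‖ * (Real.arsinh ‖u‖ / ‖u‖) = 1 by field_simp, one_smul]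

/-- `sinh √s / √s` extends to a function of `s` that is smooth on the whole line. -/
lemma exists_contDiff_sinh_div : ∃ f : ℝ → ℝ, ContDiff ℝ ∞ f ∧ f 0 = 1 ∧
    ∀ x, Real.sinh x = f (x ^ 2) * x := by
  let c : ℕ → ℝ := fun n => 1 / ((2 * n + 1).factorial : ℝ)
  have hc : ∀ n, c n ≠ 0 := fun n => by positivity
  have hr : (FormalMultilinearSeries.ofScalars ℝ c).radius = ⊤ := by
    refine FormalMultilinearSeries.ofScalars_radius_eq_top_of_tendsto (E := ℝ) (c := c)
      (Filter.Eventually.of_forall hc) ?_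
    -- the ratio test
    refine squeeze_zero (fun n => by positivity) (fun n => ?_)
      tendsto_one_div_add_atTop_nhds_zero_nat
    have h1 : (2 * (n + 1) + 1).factorial =
        (2 * n + 3) * ((2 * n + 2) * (2 * n + 1).factorial) := by
      rw [show 2 * (n + 1) + 1 = (2 * n + 1 + 1) + 1 by ring,
        Nat.factorial_succ, Nat.factorial_succ]
    simp only [c, Nat.succ_eq_add_one, Real.norm_eq_abs, abs_div, abs_one, Nat.abs_cast, h1]
    have : (0 : ℝ) < (2 * n + 1).factorial := by positivity
    push_cast
    rw [div_div_div_cancel_left' _ _ one_ne_zero]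
    rw [div_le_div_iff₀ (by positivity) (by positivity)]
    have hn : (0 : ℝ) ≤ n := by positivity
    nlinarith [mul_nonneg hn this.le, mul_nonneg (mul_nonneg hn hn) this.le]
  have hf := (FormalMultilinearSeries.ofScalars ℝ c).hasFPowerSeriesOnBall (by rw [hr]; simp)
  refine ⟨FormalMultilinearSeries.ofScalarsSum c, ?_, ?_, fun x => ?_⟩
  · have h2 : AnalyticOnNhd ℝ (FormalMultilinearSeries.ofScalars ℝ c).sum Set.univ := by
      have := hf.analyticOnNhd
      rwa [hr, Metric.eball_top] at this
    exact h2.contDiff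
  · rw [FormalMultilinearSeries.ofScalarsSum_zero]; simp [c]
  · rw [FormalMultilinearSeries.ofScalars_sum_eq, ← tsum_mul_right, ← (Real.hasSum_sinh x).tsum_eq]
    refine tsum_congr fun n => ?_
    simp only [c, smul_eq_mul]
    rw [pow_succ, pow_mul]
    ring

lemma exists_contDiff_sinhMap_eq : ∃ f : ℝ → ℝ, ContDiff ℝ ∞ f ∧ f 0 = 1 ∧
    sinhMap = fun u => f (‖u‖ ^ 2) • u := by
  obtain ⟨f, hf, hf0, hfs⟩ := exists_contDiff_sinh_div
  refine ⟨f, hf, hf0, funext fun u => ?_⟩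
  rcases eq_or_ne u 0 with rfl | hu
  · simp [sinhMap]
  · have h1 : ‖u‖ ≠ 0 := norm_ne_zero_iff.2 hu
    rw [sinhMap, hfs, mul_div_assoc, div_self h1, mul_one]

lemma contDiff_sinhMap : ContDiff ℝ ∞ sinhMap := by
  obtain ⟨f, hf, -, h⟩ := exists_contDiff_sinhMap_eq
  rw [h]
  exact (hf.comp (contDiff_norm_sq ℝ)).smul contDiff_id

lemma contDiffAt_arsinhMap_of_ne {u : Plane} (hu : u ≠ 0) : ContDiffAt ℝ ∞ arsinhMap u := by
  have h := contDiffAt_norm ℝ (n := ∞) hu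
  exact ((h.arsinh).div h (norm_ne_zero_iff.2 hu)).smul contDiffAt_id

lemma continuous_arsinhMap : Continuous arsinhMap := by
  refine continuous_iff_continuousAt.2 fun u => ?_
  rcases eq_or_ne u 0 with rfl | hu
  · rw [ContinuousAt, arsinhMap_zero, tendsto_zero_iff_norm_tendsto_zero]
    simp only [norm_arsinhMap]
    have : Continuous fun u : Plane => Real.arsinh ‖u‖ :=
      Real.continuous_arsinh.comp continuous_norm
    simpa using this.tendsto 0
  · exact (contDiffAt_arsinhMap_of_ne hu).continuousAt

/-- The change from polar to hyperboloid coordinates as a homeomorphism. -/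
def sinhHomeo : Plane ≃ₜ Plane where
  toFun := sinhMap
  invFun := arsinhMap
  left_inv := arsinhMap_sinhMap
  right_inv := sinhMap_arsinhMap
  continuous_toFun := contDiff_sinhMap.continuous
  continuous_invFun := continuous_arsinhMap

lemma hasFDerivAt_sinhMap_zero :
    HasFDerivAt sinhMap (ContinuousLinearEquiv.refl ℝ Plane : Plane →L[ℝ] Plane) 0 := by
  obtain ⟨f, hf, hf0, h⟩ := exists_contDiff_sinhMap_eq
  have h1 : DifferentiableAt ℝ (fun u : Plane => f (‖u‖ ^ 2)) 0 :=
    ((hf.comp (contDiff_norm_sq ℝ)).differentiable (by simp)) 0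
  rw [h]
  refine (h1.hasFDerivAt.smul (hasFDerivAt_id (0 : Plane))).congr_fderiv ?_
  ext v i
  simp [hf0]

lemma contDiff_arsinhMap : ContDiff ℝ ∞ arsinhMap := by
  refine contDiff_iff_contDiffAt.2 fun u => ?_
  rcases eq_or_ne u 0 with rfl | hu
  · -- at the origin, by the inverse function theorem
    refine sinhHomeo.toOpenPartialHomeomorph.contDiffAt_symm (a := 0)
      (f₀' := ContinuousLinearEquiv.refl ℝ Plane) (by simp) ?_ ?_
    · have : sinhHomeo.toOpenPartialHomeomorph.symm 0 = 0 := arsinhMap_zero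
      rw [this]; exact hasFDerivAt_sinhMap_zero
    · exact contDiff_sinhMap.contDiffAt
  · exact contDiffAt_arsinhMap_of_ne hu

lemma angle_sinhMap (u v : Plane) (hu : u ≠ 0) (hv : v ≠ 0) :
    InnerProductGeometry.angle (sinhMap u) (sinhMap v) = InnerProductGeometry.angle u v := by
  have h : ∀ w : Plane, w ≠ 0 → 0 < Real.sinh ‖w‖ / ‖w‖ := fun w hw =>
    div_pos (Real.sinh_pos_iff.2 (norm_pos_iff.2 hw)) (norm_pos_iff.2 hw)
  rw [sinhMap, sinhMap, InnerProductGeometry.angle_smul_left_of_pos _ _ (h u hu),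
    InnerProductGeometry.angle_smul_right_of_pos _ _ (h v hv)]

/-! ### Hyperbolic cones in hyperboloid coordinates -/

/-- The last coordinate `√(1 + |X|²)` of the point of the hyperboloid above `X`. -/
def hypTime (X : Plane) : ℝ := √(1 + ‖X‖ ^ 2)

/-- The hyperbolic cosine of the distance of two points of the hyperbolic cone of total angle
`2πa` in hyperboloid coordinates. -/
def hypCosh (a : ℝ) (X Y : Plane) : ℝ :=
  hypTime X * hypTime Y - ‖X‖ * ‖Y‖ * Real.cos (a * InnerProductGeometry.angle X Y)

/-- The distance of the hyperbolic cone of total angle `2πa` in hyperboloid coordinates. -/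
def hypDist (a : ℝ) (X Y : Plane) : ℝ := Real.arcosh (hypCosh a X Y)

lemma hypTime_sq (X : Plane) : hypTime X ^ 2 = 1 + ‖X‖ ^ 2 :=
  Real.sq_sqrt (by positivity)

lemma hypTime_pos (X : Plane) : 0 < hypTime X := Real.sqrt_pos.2 (by positivity)

@[simp] lemma hypTime_zero : hypTime 0 = 1 := by simp [hypTime]

lemma hypTime_sinhMap (u : Plane) : hypTime (sinhMap u) = Real.cosh ‖u‖ := by
  rw [hypTime, norm_sinhMap, ← Real.cosh_sq', Real.sqrt_sq (Real.cosh_pos _).le]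

lemma coneDist_eq_hypDist (θ : ℝ) (u v : Plane) :
    coneDist θ u v = hypDist (θ / (2 * Real.pi)) (sinhMap u) (sinhMap v) := by
  rw [coneDist, hypDist, hypCosh, hypTime_sinhMap, hypTime_sinhMap, norm_sinhMap, norm_sinhMap]
  rcases eq_or_ne u 0 with rfl | hu
  · simp
  rcases eq_or_ne v 0 with rfl | hv
  · simp
  rw [angle_sinhMap u v hu hv]

lemma one_add_mul_le_hypTime (X Y : Plane) : 1 + ‖X‖ * ‖Y‖ ≤ hypTime X * hypTime Y := by
  refine abs_le_of_sq_le_sq' ?_ (mul_pos (hypTime_pos X) (hypTime_pos Y)).le |>.2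
  rw [mul_pow, hypTime_sq, hypTime_sq]
  nlinarith [sq_nonneg (‖X‖ - ‖Y‖)]

lemma one_le_hypCosh (a : ℝ) (X Y : Plane) : 1 ≤ hypCosh a X Y := by
  have h1 := one_add_mul_le_hypTime X Y
  have h2 := mul_le_mul_of_nonneg_left (Real.cos_le_one (a * InnerProductGeometry.angle X Y))
    (mul_nonneg (norm_nonneg X) (norm_nonneg Y))
  rw [hypCosh]; linarith

lemma cosh_hypDist (a : ℝ) (X Y : Plane) : Real.cosh (hypDist a X Y) = hypCosh a X Y :=
  Real.cosh_arcosh (one_le_hypCosh a X Y)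

lemma hypDist_inj {a b : ℝ} {X Y Z W : Plane} :
    hypDist a X Y = hypDist b Z W ↔ hypCosh a X Y = hypCosh b Z W :=
  Real.arcosh_injOn.eq_iff (one_le_hypCosh a X Y) (one_le_hypCosh b Z W)

lemma hypDist_zero_left (a : ℝ) (X : Plane) : hypDist a 0 X = Real.arsinh ‖X‖ := by
  have : hypCosh a 0 X = Real.cosh (Real.arsinh ‖X‖) := by
    rw [hypCosh, Real.cosh_arsinh, hypTime_zero, hypTime]; simp
  rw [hypDist, this, Real.arcosh_cosh (Real.arsinh_nonneg_iff.2 (norm_nonneg _))]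

lemma hypCosh_one (X Y : Plane) : hypCosh 1 X Y = hypTime X * hypTime Y - inner ℝ X Y := by
  rw [hypCosh, one_mul, mul_comm (‖X‖ * ‖Y‖), InnerProductGeometry.cos_angle_mul_norm_mul_norm]

lemma contDiff_hypTime : ContDiff ℝ ∞ hypTime :=
  (contDiff_const.add (contDiff_norm_sq ℝ)).sqrt fun X => (by positivity : (0:ℝ) < _).ne'

/-! ### Isometries of cones fixing the apex -/

/-- A map fixing the apex and respecting distances near it respects norms, and multiplies angles
by `a / b`. -/
lemma norm_eq_and_angle_eq_of_hypDist_eq {a b ε : ℝ} (ha : 0 < a) (ha1 : a ≤ 1) (hb : 0 < b)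
    (hb1 : b ≤ 1) (hε : 0 < ε) {F : Plane → Plane} (hF0 : F 0 = 0)
    (hF : ∀ X ∈ Metric.ball 0 ε, ∀ Y ∈ Metric.ball 0 ε, hypDist b (F X) (F Y) = hypDist a X Y) :
    (∀ X ∈ Metric.ball 0 ε, ‖F X‖ = ‖X‖) ∧
    ∀ X ∈ Metric.ball 0 ε, ∀ Y ∈ Metric.ball 0 ε, X ≠ 0 → Y ≠ 0 →
      b * InnerProductGeometry.angle (F X) (F Y) = a * InnerProductGeometry.angle X Y := by
  have hn : ∀ X ∈ Metric.ball 0 ε, ‖F X‖ = ‖X‖ := by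
    intro X hX
    have := hF 0 (Metric.mem_ball_self hε) X hX
    rwa [hF0, hypDist_zero_left, hypDist_zero_left, Real.arsinh_inj] at this
  refine ⟨hn, fun X hX Y hY hX0 hY0 => ?_⟩
  have h := hypDist_inj.1 (hF X hX Y hY)
  have hX1 := norm_ne_zero_iff.2 hX0
  have hY1 := norm_ne_zero_iff.2 hY0
  rw [hypCosh, hypCosh, hypTime, hypTime, hn X hX, hn Y hY, ← hypTime, ← hypTime, sub_right_inj,
    mul_right_inj' (mul_ne_zero hX1 hY1)] at h
  have hmem : ∀ c : ℝ, 0 < c → c ≤ 1 → ∀ Z W : Plane,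
      c * InnerProductGeometry.angle Z W ∈ Set.Icc 0 Real.pi := fun c hc hc1 Z W =>
    ⟨mul_nonneg hc.le (InnerProductGeometry.angle_nonneg _ _),
      (mul_le_of_le_one_left (InnerProductGeometry.angle_nonneg _ _) hc1).trans
        (InnerProductGeometry.angle_le_pi _ _)⟩
  -- all angles involved are at most `π`, since the cone angles are at most `2π`
  exact Real.injOn_cos (hmem b hb hb1 _ _) (hmem a ha ha1 _ _) h

lemma exists_ne_zero_mem_ball {ε : ℝ} (hε : 0 < ε) :
    ∃ X : Plane, X ≠ 0 ∧ X ∈ Metric.ball 0 ε ∧ -X ∈ Metric.ball 0 ε := by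
  refine ⟨EuclideanSpace.single 0 (ε / 2), ?_, ?_, ?_⟩
  · simp [hε.ne']
  · simp [abs_of_pos hε, hε]
  · simp [abs_of_pos hε, hε]

/-- Opposite directions show that an isometry cannot decrease the cone angle. -/
lemma le_of_hypDist_eq {a b ε : ℝ} (ha : 0 < a) (ha1 : a ≤ 1) (hb : 0 < b)
    (hb1 : b ≤ 1) (hε : 0 < ε) {F : Plane → Plane} (hF0 : F 0 = 0)
    (hF : ∀ X ∈ Metric.ball 0 ε, ∀ Y ∈ Metric.ball 0 ε, hypDist b (F X) (F Y) = hypDist a X Y) :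
    a ≤ b := by
  obtain ⟨X, hX0, hX, hX'⟩ := exists_ne_zero_mem_ball hε
  have h := (norm_eq_and_angle_eq_of_hypDist_eq ha ha1 hb hb1 hε hF0 hF).2 X hX (-X) hX' hX0
    (neg_ne_zero.2 hX0)
  rw [InnerProductGeometry.angle_self_neg_of_nonzero hX0] at h
  have h2 := mul_le_mul_of_nonneg_left (InnerProductGeometry.angle_le_pi (F X) (F (-X))) hb.le
  exact le_of_mul_le_mul_right (h ▸ h2) Real.pi_pos

/-- An isometry of a cone fixing the apex is linear near it, since it respects inner products. -/
lemma exists_linear_of_hypDist_eq {a ε : ℝ} (ha : 0 < a) (ha1 : a ≤ 1) (hε : 0 < ε)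
    {F : Plane → Plane} (hF0 : F 0 = 0)
    (hF : ∀ X ∈ Metric.ball 0 ε, ∀ Y ∈ Metric.ball 0 ε, hypDist a (F X) (F Y) = hypDist a X Y) :
    ∃ L : Plane →L[ℝ] Plane, ∀ X ∈ Metric.ball 0 ε, F X = L X := by
  obtain ⟨hn, hang⟩ := norm_eq_and_angle_eq_of_hypDist_eq ha ha1 ha ha1 hε hF0 hF
  have hin : ∀ X ∈ Metric.ball 0 ε, ∀ Y ∈ Metric.ball 0 ε, inner ℝ (F X) (F Y) = inner ℝ X Y := by
    intro X hX Y hY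
    rcases eq_or_ne X 0 with rfl | hX0
    · simp [hF0]
    rcases eq_or_ne Y 0 with rfl | hY0
    · simp [hF0]
    rw [← InnerProductGeometry.cos_angle_mul_norm_mul_norm,
      ← InnerProductGeometry.cos_angle_mul_norm_mul_norm, hn X hX, hn Y hY,
      mul_left_cancel₀ ha.ne' (hang X hX Y hY hX0 hY0)]
  set e : Fin 2 → Plane := fun i => EuclideanSpace.single i (ε / 2) with he
  have hemem : ∀ i, e i ∈ Metric.ball 0 ε := fun i => by simp [he, abs_of_pos hε, hε]
  let L : Plane →L[ℝ] Plane := ∑ i, ((EuclideanSpace.proj i : Plane →L[ℝ] ℝ).smulRight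
    ((2 / ε) • F (e i)))
  refine ⟨L, fun X hX => ?_⟩
  have hLX : L X = (X 0 * (2 / ε)) • F (e 0) + (X 1 * (2 / ε)) • F (e 1) := by
    simp [L, Fin.sum_univ_two, smul_smul]
  have h1 : ∀ i, inner ℝ (F X) (F (e i)) = ε / 2 * X i := fun i => by
    rw [hin X hX _ (hemem i), he]; simp [EuclideanSpace.inner_single_right]
  have h2 : ∀ i j, inner ℝ (F (e i)) (F (e j)) = if i = j then (ε / 2) ^ 2 else 0 := fun i j => by
    rw [hin _ (hemem i) _ (hemem j), he]
    simp only [EuclideanSpace.inner_single_right, PiLp.single_apply]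
    fin_cases i <;> fin_cases j <;> simp <;> ring
  have h3 : inner ℝ (F X) (F X) = X 0 ^ 2 + X 1 ^ 2 := by
    rw [hin X hX X hX, real_inner_self_eq_norm_sq, plane_norm_sq]
  -- expand the squared norm of `F X - L X`, all of whose terms are known
  rw [← sub_eq_zero, ← inner_self_eq_zero (𝕜 := ℝ), hLX]
  simp only [inner_sub_left, inner_sub_right, inner_add_left, inner_add_right, inner_smul_left,
    inner_smul_right, h1, h2, h3, real_inner_comm (F X)]
  simp
  field_simp
  ring

/-! ### Hyperbolic translations -/

/-- The Lorentz boost moving `P` to the origin, in hyperboloid coordinates. -/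
def boost (P Y : Plane) : Plane := Y + (inner ℝ P Y / (1 + hypTime P) - hypTime Y) • P

lemma contDiff_boost (P : Plane) : ContDiff ℝ ∞ (boost P) := by
  refine contDiff_id.add (ContDiff.smul (ContDiff.sub ?_ contDiff_hypTime) contDiff_const)
  exact (contDiff_const.inner ℝ contDiff_id).div_const _

lemma hypTime_neg (P : Plane) : hypTime (-P) = hypTime P := by simp [hypTime]

lemma hypTime_boost (P Y : Plane) :
    hypTime (boost P Y) = hypTime P * hypTime Y - inner ℝ P Y := by
  have h1 := hypTime_sq P
  have h2 := hypTime_sq Y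
  have h3 := hypTime_pos P
  have hpos : 0 ≤ hypTime P * hypTime Y - inner ℝ P Y := by
    linarith [one_add_mul_le_hypTime P Y, real_inner_le_norm P Y]
  rw [← sq_eq_sq₀ (hypTime_pos _).le hpos, hypTime_sq, boost, norm_add_sq_real, norm_smul, mul_pow,
    inner_smul_right, real_inner_comm P Y, Real.norm_eq_abs, sq_abs]
  rw [show ‖P‖ ^ 2 = hypTime P ^ 2 - 1 by linarith, show ‖Y‖ ^ 2 = hypTime Y ^ 2 - 1 by linarith]
  have : 1 + hypTime P ≠ 0 := by positivity
  field_simp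
  ring

lemma hypCosh_boost (P Y Z : Plane) : hypCosh 1 (boost P Y) (boost P Z) = hypCosh 1 Y Z := by
  have h1 := hypTime_sq P
  have h3 := hypTime_pos P
  rw [hypCosh_one, hypCosh_one, hypTime_boost, hypTime_boost, boost, boost]
  simp only [inner_add_left, inner_add_right, inner_smul_left, inner_smul_right]
  rw [real_inner_self_eq_norm_sq, show ‖P‖ ^ 2 = hypTime P ^ 2 - 1 by linarith,
    real_inner_comm P Y]
  have : 1 + hypTime P ≠ 0 := by positivity
  simp
  field_simp
  ring

lemma boost_self (P : Plane) : boost P P = 0 := by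
  have h1 := hypTime_sq P
  have h3 := hypTime_pos P
  have : inner ℝ P P / (1 + hypTime P) - hypTime P = -1 := by
    rw [real_inner_self_eq_norm_sq, show ‖P‖ ^ 2 = hypTime P ^ 2 - 1 by linarith]
    have : 1 + hypTime P ≠ 0 := by positivity
    field_simp
    ring
  rw [boost, this]; simp

lemma boost_neg_boost (P Y : Plane) : boost (-P) (boost P Y) = Y := by
  have h1 := hypTime_sq P
  have h3 := hypTime_pos P
  have h4 : 1 + hypTime P ≠ 0 := by positivity
  rw [boost, hypTime_boost, hypTime_neg, boost, inner_add_right, inner_smul_right, inner_neg_left,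
    inner_neg_left, real_inner_self_eq_norm_sq, show ‖P‖ ^ 2 = hypTime P ^ 2 - 1 by linarith,
    add_assoc, smul_neg, ← sub_eq_add_neg, ← sub_smul]
  convert add_zero Y using 2
  convert zero_smul ℝ P using 2
  field_simp
  ring

lemma boost_boost_neg (P Y : Plane) : boost P (boost (-P) Y) = Y := by
  simpa using boost_neg_boost (-P) Y

/-! ### Developing a cone into the hyperbolic plane -/

/-- The map of the plane multiplying by `b` the angle measured from the direction `p`, and taking
the direction `p` to `q`. It is smooth away from the ray opposite to `p`. -/
def twist (b : ℝ) (p q z : ℂ) : ℂ := ‖z‖ * q * Complex.exp ((b * (z / p).arg : ℝ) * Complex.I)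

lemma arg_mul_exp {r t : ℝ} (hr : 0 < r) (ht : |t| < Real.pi) :
    (r * Complex.exp (t * Complex.I)).arg = t := by
  rw [Complex.arg_real_mul _ hr, Complex.arg_exp_mul_I, toIocMod_eq_self]
  constructor <;> [skip; ring_nf] <;> linarith [abs_lt.1 ht]

lemma norm_twist {b : ℝ} {p q z : ℂ} (hq : ‖q‖ = 1) : ‖twist b p q z‖ = ‖z‖ := by
  rw [twist, norm_mul, norm_mul, hq, Complex.norm_exp_ofReal_mul_I, Complex.norm_real, norm_norm,
    mul_one, mul_one]

lemma norm_mul_mul_exp_arg {p z : ℂ} (hp : ‖p‖ = 1) :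
    ‖z‖ * p * Complex.exp ((z / p).arg * Complex.I) = z := by
  have hp0 : p ≠ 0 := norm_ne_zero_iff.1 (by simp [hp])
  have h := Complex.norm_mul_exp_arg_mul_I (z / p)
  rw [norm_div, hp, div_one] at h
  rw [mul_right_comm, h, div_mul_cancel₀ _ hp0]

lemma arg_twist_div {b : ℝ} {p q z : ℂ} (hq : ‖q‖ = 1) (hz : z ≠ 0)
    (hb : |b * (z / p).arg| < Real.pi) : (twist b p q z / q).arg = b * (z / p).arg := by
  have hq0 : q ≠ 0 := norm_ne_zero_iff.1 (by simp [hq])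
  rw [twist, mul_right_comm, mul_div_cancel_right₀ _ hq0]
  exact arg_mul_exp (norm_pos_iff.2 hz) hb

lemma twist_inv_twist {b : ℝ} {p q z : ℂ} (hb0 : b ≠ 0) (hp : ‖p‖ = 1) (hq : ‖q‖ = 1) (hz : z ≠ 0)
    (hb : |b * (z / p).arg| < Real.pi) : twist b⁻¹ q p (twist b p q z) = z := by
  rw [twist, arg_twist_div hq hz hb, norm_twist hq, inv_mul_cancel_left₀ hb0]
  exact norm_mul_mul_exp_arg hp

lemma angle_mul_exp {p : ℂ} (hp : ‖p‖ = 1) {r s α β : ℝ} (hr : 0 < r) (hs : 0 < s)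
    (h : |α - β| < Real.pi) : InnerProductGeometry.angle (r * p * Complex.exp (α * Complex.I))
      (s * p * Complex.exp (β * Complex.I)) = |α - β| := by
  have hp0 : p ≠ 0 := norm_ne_zero_iff.1 (by simp [hp])
  have hr0 : (r : ℂ) ≠ 0 := by exact_mod_cast hr.ne'
  have hs0 : (s : ℂ) ≠ 0 := by exact_mod_cast hs.ne'
  rw [Complex.angle_eq_abs_arg (mul_ne_zero (mul_ne_zero hr0 hp0) (Complex.exp_ne_zero _))
    (mul_ne_zero (mul_ne_zero hs0 hp0) (Complex.exp_ne_zero _))]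
  have : r * p * Complex.exp (α * Complex.I) / (s * p * Complex.exp (β * Complex.I)) =
      ((r / s : ℝ) : ℂ) * Complex.exp ((α - β : ℝ) * Complex.I) := by
    push_cast
    rw [sub_mul, Complex.exp_sub]
    field_simp
  rw [this, arg_mul_exp (div_pos hr hs) h]

lemma angle_twist {b : ℝ} {p q z w : ℂ} (hb0 : 0 < b) (hb1 : b ≤ 1) (hp : ‖p‖ = 1) (hq : ‖q‖ = 1)
    (hz : z ≠ 0) (hw : w ≠ 0) (h : |(z / p).arg - (w / p).arg| < Real.pi) :
    InnerProductGeometry.angle (twist b p q z) (twist b p q w) =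
      b * InnerProductGeometry.angle z w := by
  have h2 : b * (z / p).arg - b * (w / p).arg = b * ((z / p).arg - (w / p).arg) := by ring
  have h3 : |b * (z / p).arg - b * (w / p).arg| = b * |(z / p).arg - (w / p).arg| := by
    rw [h2, abs_mul, abs_of_pos hb0]
  rw [twist, twist, angle_mul_exp hq (norm_pos_iff.2 hz) (norm_pos_iff.2 hw), h3]
  · congr 1
    conv_rhs => rw [← norm_mul_mul_exp_arg (z := z) hp, ← norm_mul_mul_exp_arg (z := w) hp]
    rw [angle_mul_exp hp (norm_pos_iff.2 hz) (norm_pos_iff.2 hw) h]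
  · rw [h3]
    exact (mul_le_of_le_one_left (abs_nonneg _) hb1).trans_lt h

lemma contDiffAt_twist {b : ℝ} {p q z : ℂ} (h : z / p ∈ Complex.slitPlane) :
    ContDiffAt ℝ ∞ (twist b p q) z := by
  have hz : z ≠ 0 := by rintro rfl; simp at h
  have h1 : ContDiffAt ℝ ∞ (fun z : ℂ => (z / p).arg) z := by
    have h2 : ContDiffAt ℂ ∞ (fun z : ℂ => Complex.log (z / p)) z :=
      ContDiffAt.comp z (Complex.contDiffAt_log h) (contDiffAt_id.div_const p)
    have h3 : ContDiffAt ℝ ∞ (fun z : ℂ => (Complex.log (z / p)).im) z :=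
      Complex.imCLM.contDiff.contDiffAt.comp z (h2.restrict_scalars ℝ)
    simpa only [Complex.log_im] using h3
  have h4 : ContDiffAt ℝ ∞ (fun z : ℂ => ((‖z‖ : ℝ) : ℂ)) z :=
    Complex.ofRealCLM.contDiff.contDiffAt.comp z (contDiffAt_norm ℝ hz)
  have h5 : ContDiffAt ℝ ∞ (fun z : ℂ => ((b * (z / p).arg : ℝ) : ℂ)) z :=
    Complex.ofRealCLM.contDiff.contDiffAt.comp z (contDiffAt_const.mul h1)
  exact (h4.mul contDiffAt_const).mul (h5.mul contDiffAt_const).cexp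

/-- The identification of the plane with `ℂ`. -/
def planeEquivComplex : Plane ≃ₗᵢ[ℝ] ℂ := Complex.orthonormalBasisOneI.repr.symm

lemma contDiffAt_conj_planeEquivComplex {f : ℂ → ℂ} {X : Plane}
    (hf : ContDiffAt ℝ ∞ f (planeEquivComplex X)) :
    ContDiffAt ℝ ∞ (fun Y => planeEquivComplex.symm (f (planeEquivComplex Y))) X :=
  planeEquivComplex.symm.contDiff.contDiffAt.comp X
    (ContDiffAt.comp X hf planeEquivComplex.contDiff.contDiffAt)

/-- Every point `X₀` of a cone other than the apex has a neighbourhood that develops smoothly and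
isometrically onto a neighbourhood of the origin of the hyperbolic plane. -/
theorem exists_development {a : ℝ} (ha : 0 < a) (ha1 : a ≤ 1) {X₀ : Plane} (hX₀ : X₀ ≠ 0) :
    ∃ M M' : Plane → Plane, ContDiffAt ℝ ∞ M X₀ ∧ ContDiffAt ℝ ∞ M' 0 ∧ M X₀ = 0 ∧ M' 0 = X₀ ∧
      (∀ᶠ X in nhds X₀, M' (M X) = X) ∧ (∀ᶠ Z in nhds 0, M (M' Z) = Z) ∧
      ∃ U ∈ nhds X₀, ∀ X ∈ U, ∀ Y ∈ U, hypDist 1 (M X) (M Y) = hypDist a X Y := by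
  let ι := planeEquivComplex
  set z₀ : ℂ := ι X₀ with hz₀
  have hz₀0 : z₀ ≠ 0 := by simpa [hz₀] using hX₀
  have hn0 : (‖z₀‖ : ℂ) ≠ 0 := by exact_mod_cast norm_ne_zero_iff.2 hz₀0
  set p : ℂ := z₀ / ‖z₀‖ with hp
  have hp1 : ‖p‖ = 1 := by
    rw [hp, norm_div, Complex.norm_real, norm_norm, div_self (norm_ne_zero_iff.2 hz₀0)]
  have hq1 : ‖(1 : ℂ)‖ = 1 := norm_one
  have hp0 : p ≠ 0 := norm_ne_zero_iff.1 (by simp [hp1])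
  have hzp : z₀ / p = ‖z₀‖ := by rw [hp]; field_simp
  have hzslit : z₀ / p ∈ Complex.slitPlane := by
    rw [hzp]; exact Complex.ofReal_mem_slitPlane.2 (norm_pos_iff.2 hz₀0)
  have harg0 : (z₀ / p).arg = 0 := by rw [hzp]; exact Complex.arg_ofReal_of_nonneg (norm_nonneg _)
  have htw : twist a p 1 z₀ = ‖z₀‖ := by simp [twist, harg0]
  -- `T` multiplies angles by `a`, which turns the cone into the hyperbolic plane near `X₀`; a boost
  -- then moves the image `P` of `X₀` to the origin
  let T : Plane → Plane := fun X => ι.symm (twist a p 1 (ι X))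
  let T' : Plane → Plane := fun X => ι.symm (twist a⁻¹ 1 p (ι X))
  set P : Plane := T X₀ with hP
  have hιP : ι P = ‖z₀‖ := by simp only [hP, T, LinearIsometryEquiv.apply_symm_apply]; exact htw
  have hιPslit : ι P / 1 ∈ Complex.slitPlane := by
    rw [div_one, hιP]; exact Complex.ofReal_mem_slitPlane.2 (norm_pos_iff.2 hz₀0)
  have hT : ContDiffAt ℝ ∞ T X₀ := contDiffAt_conj_planeEquivComplex (contDiffAt_twist hzslit)
  have hT' : ContDiffAt ℝ ∞ T' P := contDiffAt_conj_planeEquivComplex (contDiffAt_twist hιPslit)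
  have hTT : ∀ X, ι (T X) = twist a p 1 (ι X) := fun X => ι.apply_symm_apply _
  have hTT' : ∀ X, ι (T' X) = twist a⁻¹ 1 p (ι X) := fun X => ι.apply_symm_apply _
  have hne : ∀ᶠ X in nhds X₀, ι X ≠ 0 :=
    (ι.continuous.continuousAt (x := X₀)).eventually_ne hz₀0
  have hneP : ∀ᶠ X in nhds P, ι X ≠ 0 :=
    (ι.continuous.continuousAt (x := P)).eventually_ne (by rw [hιP]; exact hn0)
  have hargc : ContinuousAt (fun X => (ι X / p).arg) X₀ :=
    (Complex.continuousAt_arg hzslit).comp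
      (f := fun X => ι X / p) (ι.continuous.div_const p).continuousAt
  have hargcP : ContinuousAt (fun X => (ι X / 1).arg) P :=
    (Complex.continuousAt_arg hιPslit).comp
      (f := fun X => ι X / 1) (ι.continuous.div_const 1).continuousAt
  have hargP : (ι P / 1).arg = 0 := by
    rw [div_one, hιP]; exact Complex.arg_ofReal_of_nonneg (norm_nonneg _)
  have hsm : ∀ᶠ X in nhds X₀, |(ι X / p).arg| < Real.pi / 2 :=
    (continuous_abs.continuousAt.comp hargc).eventually
      (gt_mem_nhds (by simp only [Function.comp]; rw [← hz₀, harg0, abs_zero]; positivity))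
  have hsmP : ∀ᶠ X in nhds P, |a⁻¹ * (ι X / 1).arg| < Real.pi :=
    (continuous_abs.continuousAt.comp (hargcP.const_mul a⁻¹)).eventually
      (gt_mem_nhds (by simp only [Function.comp]; rw [hargP, mul_zero, abs_zero]; positivity))
  have hinv : ∀ᶠ X in nhds X₀, T' (T X) = X := by
    filter_upwards [hne, hsm] with X hX hX'
    rw [← ι.injective.eq_iff, hTT', hTT]
    refine twist_inv_twist ha.ne' hp1 hq1 hX ?_
    rw [abs_mul, abs_of_pos ha]
    exact (mul_le_of_le_one_left (abs_nonneg _) ha1).trans_lt (by linarith [Real.pi_pos])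
  have hinv' : ∀ᶠ X in nhds P, T (T' X) = X := by
    filter_upwards [hneP, hsmP] with X hX hX'
    rw [← ι.injective.eq_iff, hTT, hTT']
    have := twist_inv_twist (inv_ne_zero ha.ne') hq1 hp1 hX hX'
    rwa [inv_inv] at this
  have hbneg : boost (-P) 0 = P := by rw [← boost_self P, boost_neg_boost]
  refine ⟨fun X => boost P (T X), fun Z => T' (boost (-P) Z),
    (contDiff_boost P).contDiffAt.comp X₀ hT, ?_, boost_self P, ?_, ?_, ?_, ?_⟩
  · exact ContDiffAt.comp (g := T') (f := boost (-P)) 0 (by rwa [hbneg])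
      (contDiff_boost (-P)).contDiffAt
  · simp only [hbneg]
    exact hinv.self_of_nhds
  · filter_upwards [hinv] with X hX
    rw [boost_neg_boost, hX]
  · have : Filter.Tendsto (boost (-P)) (nhds 0) (nhds P) := by
      simpa only [hbneg] using (contDiff_boost (-P)).continuous.tendsto 0
    filter_upwards [this.eventually hinv'] with Z hZ
    rw [hZ, boost_boost_neg]
  · refine ⟨{X | ι X ≠ 0 ∧ |(ι X / p).arg| < Real.pi / 2}, hne.and hsm, fun X hX Y hY => ?_⟩
    rw [hypDist_inj, hypCosh_boost, hypCosh, hypCosh]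
    have hnT : ∀ X, ‖T X‖ = ‖X‖ := fun X => by
      rw [← ι.norm_map, hTT, norm_twist hq1, ι.norm_map]
    have hang : InnerProductGeometry.angle (T X) (T Y) = a * InnerProductGeometry.angle X Y := by
      rw [← ι.toLinearIsometry.angle_map (T X), ← ι.toLinearIsometry.angle_map X]
      change InnerProductGeometry.angle (ι (T X)) (ι (T Y)) =
        a * InnerProductGeometry.angle (ι X) (ι Y)
      rw [hTT, hTT, angle_twist ha ha1 hp1 hq1 hX.1 hY.1]
      exact (abs_sub _ _).trans_lt (by linarith [hX.2, hY.2])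
    rw [hypTime, hypTime, hnT, hnT, hang, one_mul, hypTime, hypTime]

section

/-! ### Smoothness of the transition maps -/

/-- The cone angle, divided by `2π`, at the point `X` of the cone of total angle `2πa`. -/
def angleParam (a : ℝ) (X : Plane) : ℝ := if X = 0 then a else 1

lemma angleParam_pos {a : ℝ} (ha : 0 < a) (X : Plane) : 0 < angleParam a X := by
  unfold angleParam; split_ifs <;> simp [ha]

lemma angleParam_le_one {a : ℝ} (ha : a ≤ 1) (X : Plane) : angleParam a X ≤ 1 := by
  unfold angleParam; split_ifs <;> simp [ha]

/-- Every point of a cone has a neighbourhood that is mapped smoothly and isometrically onto a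
neighbourhood of the apex of the cone with the angle of this point. -/
lemma exists_centering {a : ℝ} (ha : 0 < a) (ha1 : a ≤ 1) (X₀ : Plane) :
    ∃ M M' : Plane → Plane, ContDiffAt ℝ ∞ M X₀ ∧ ContDiffAt ℝ ∞ M' 0 ∧ M X₀ = 0 ∧ M' 0 = X₀ ∧
      (∀ᶠ X in nhds X₀, M' (M X) = X) ∧ (∀ᶠ Z in nhds 0, M (M' Z) = Z) ∧
      ∃ U ∈ nhds X₀, ∀ X ∈ U, ∀ Y ∈ U,
        hypDist (angleParam a X₀) (M X) (M Y) = hypDist a X Y := by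
  rcases eq_or_ne X₀ 0 with rfl | hX₀
  · refine ⟨id, id, contDiffAt_id, contDiffAt_id, rfl, rfl, ?_, ?_, Set.univ, Filter.univ_mem, ?_⟩
      <;> simp [angleParam]
  · simpa only [angleParam, if_neg hX₀] using exists_development ha ha1 hX₀

/-- `e` is an isometry of the ball of radius `r` about `p` onto the ball of radius `r` about the
apex of the hyperbolic cone of total angle `2πa`, in hyperboloid coordinates. -/
structure IsHypChart {S : Type*} [MetricSpace S] (a : ℝ) (p : S) (r : ℝ)
    (e : OpenPartialHomeomorph S Plane) : Prop where
  source_eq : e.source = Metric.ball p r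
  target_eq : e.target = Metric.ball 0 (Real.sinh r)
  map_center : e p = 0
  dist_eq : ∀ x ∈ Metric.ball p r, ∀ y ∈ Metric.ball p r, dist x y = hypDist a (e x) (e y)

variable {S : Type*} [MetricSpace S]

lemma IsHypChart.dist_eq_of_mem {a r : ℝ} {p : S} {e : OpenPartialHomeomorph S Plane}
    (h : IsHypChart a p r e) {x y : S} (hx : x ∈ e.source) (hy : y ∈ e.source) :
    dist x y = hypDist a (e x) (e y) :=
  h.dist_eq x (h.source_eq ▸ hx) y (h.source_eq ▸ hy)

lemma IsHypChart.norm_eq {a r : ℝ} {p : S} {e : OpenPartialHomeomorph S Plane}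
    (h : IsHypChart a p r e) {x : S} (hx : x ∈ e.source) : ‖e x‖ = Real.sinh (dist p x) := by
  have hx' := h.source_eq ▸ hx
  have hp : p ∈ Metric.ball p r :=
    Metric.mem_ball_self (dist_nonneg.trans_lt (Metric.mem_ball.1 hx'))
  rw [h.dist_eq p hp x hx', h.map_center, hypDist_zero_left, Real.sinh_arsinh]

lemma IsHypChart.apply_eq_zero_iff {a r : ℝ} {p : S} {e : OpenPartialHomeomorph S Plane}
    (h : IsHypChart a p r e) {x : S} (hx : x ∈ e.source) : e x = 0 ↔ x = p := by
  rw [← norm_eq_zero, h.norm_eq hx, Real.sinh_eq_zero, dist_eq_zero, eq_comm]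

/-- Where two charts overlap, both change coordinates by centering maps to an isometry between
cones fixing the apex. -/
lemma exists_centered_transition {a a' r r' : ℝ} {p p' : S} {e e' : OpenPartialHomeomorph S Plane}
    (ha : 0 < a) (ha1 : a ≤ 1) (ha' : 0 < a') (ha1' : a' ≤ 1)
    (h : IsHypChart a p r e) (h' : IsHypChart a' p' r' e') {x : S} (hx : x ∈ e.source)
    (hx' : x ∈ e'.source) :
    ∃ (M N' F : Plane → Plane) (ε : ℝ), 0 < ε ∧ ContDiffAt ℝ ∞ M (e x) ∧ ContDiffAt ℝ ∞ N' 0 ∧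
      M (e x) = 0 ∧ F 0 = 0 ∧
      (∀ X ∈ Metric.ball 0 ε, ∀ Y ∈ Metric.ball 0 ε,
        hypDist (angleParam a' (e' x)) (F X) (F Y) = hypDist (angleParam a (e x)) X Y) ∧
      ∀ᶠ Y in nhds (e x), e' (e.symm Y) = N' (F (M Y)) := by
  obtain ⟨M, M', hM, hM', hMx, hM'0, hM'M, hMM', U, hU, hUd⟩ := exists_centering ha ha1 (e x)
  obtain ⟨N, N', hN, hN', hNx, -, hN'N, -, W, hW, hWd⟩ := exists_centering ha' ha1' (e' x)
  have hF : ContinuousAt (fun Y => e' (e.symm Y)) (e x) := by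
    refine ContinuousAt.comp (g := e') ?_ (e.continuousAt_symm (e.map_source hx))
    rw [e.left_inv hx]; exact e'.continuousAt hx'
  have hFx : e' (e.symm (e x)) = e' x := by rw [e.left_inv hx]
  have hF' := hF.tendsto
  simp only [hFx] at hF'
  have hsrc : ∀ᶠ Y in nhds (e x), Y ∈ e.target ∧ e.symm Y ∈ e'.source := by
    refine (e.open_target.eventually_mem (e.map_source hx)).and ?_
    refine (e.continuousAt_symm (e.map_source hx)).eventually ?_
    rw [e.left_inv hx]
    exact e'.open_source.eventually_mem hx'
  have hW' : ∀ᶠ Y in nhds (e x), e' (e.symm Y) ∈ W :=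
    hF'.eventually hW
  have hN'N' : ∀ᶠ Y in nhds (e x), N' (N (e' (e.symm Y))) = e' (e.symm Y) :=
    hF'.eventually hN'N
  have hall : ∀ᶠ Z in nhds 0, (M' Z ∈ e.target ∧ e.symm (M' Z) ∈ e'.source) ∧
      e' (e.symm (M' Z)) ∈ W ∧ M' Z ∈ U ∧ M (M' Z) = Z := by
    have h0 : Filter.Tendsto M' (nhds 0) (nhds (e x)) := by
      have := hM'.continuousAt.tendsto
      rwa [hM'0] at this
    exact (h0.eventually hsrc).and ((h0.eventually hW').and ((h0.eventually hU).and hMM'))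
  obtain ⟨ε, hε, hball⟩ := Metric.eventually_nhds_iff_ball.1 hall
  refine ⟨M, N', fun Z => N (e' (e.symm (M' Z))), ε, hε, hM, hN', hMx, ?_, ?_, ?_⟩
  · simp only [hM'0, hFx, hNx]
  · intro Z hZ Y hY
    obtain ⟨⟨h1, h2⟩, h3, h4, h5⟩ := hball Z hZ
    obtain ⟨⟨k1, k2⟩, k3, k4, k5⟩ := hball Y hY
    rw [hWd _ h3 _ k3, ← h'.dist_eq_of_mem h2 k2,
      h.dist_eq_of_mem (e.map_target h1) (e.map_target k1), e.right_inv h1, e.right_inv k1,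
      ← hUd _ h4 _ k4, h5, k5]
  · filter_upwards [hM'M, hN'N'] with Y hY hY'
    rw [hY, hY']

lemma angleParam_le_of_mem {a a' r r' : ℝ} {p p' : S} {e e' : OpenPartialHomeomorph S Plane}
    (ha : 0 < a) (ha1 : a ≤ 1) (ha' : 0 < a') (ha1' : a' ≤ 1)
    (h : IsHypChart a p r e) (h' : IsHypChart a' p' r' e') {x : S} (hx : x ∈ e.source)
    (hx' : x ∈ e'.source) : angleParam a (e x) ≤ angleParam a' (e' x) := by
  obtain ⟨M, N', F, ε, hε, -, -, -, hF0, hF, -⟩ :=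
    exists_centered_transition ha ha1 ha' ha1' h h' hx hx'
  exact le_of_hypDist_eq (angleParam_pos ha _) (angleParam_le_one ha1 _) (angleParam_pos ha' _)
    (angleParam_le_one ha1' _) hε hF0 hF

/-- The cone angle of a point does not depend on the chart. -/
lemma angleParam_eq_of_mem {a a' r r' : ℝ} {p p' : S} {e e' : OpenPartialHomeomorph S Plane}
    (ha : 0 < a) (ha1 : a ≤ 1) (ha' : 0 < a') (ha1' : a' ≤ 1)
    (h : IsHypChart a p r e) (h' : IsHypChart a' p' r' e') {x : S} (hx : x ∈ e.source)
    (hx' : x ∈ e'.source) : angleParam a (e x) = angleParam a' (e' x) :=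
  le_antisymm (angleParam_le_of_mem ha ha1 ha' ha1' h h' hx hx')
    (angleParam_le_of_mem ha' ha1' ha ha1 h' h hx' hx)

/-- The singular points in the domain of a chart are the centre at most. -/
lemma IsHypChart.eq_center_of_singular {a a' r r' : ℝ} {p p' : S}
    {e e' : OpenPartialHomeomorph S Plane}
    (ha : 0 < a) (ha1 : a < 1) (ha' : 0 < a') (ha1' : a' ≤ 1)
    (h : IsHypChart a p r e) (h' : IsHypChart a' p' r' e') (hp : p ∈ e.source)
    (hp' : p ∈ e'.source) : p = p' := by
  have h1 := angleParam_eq_of_mem ha ha1.le ha' ha1' h h' hp hp'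
  by_contra hne
  rw [angleParam, angleParam, if_pos h.map_center, if_neg] at h1
  · exact ha1.ne h1
  · rwa [h'.apply_eq_zero_iff hp']

/-- The transition maps are smooth, since after centering they are linear. -/
theorem contDiffAt_transition {a a' r r' : ℝ} {p p' : S} {e e' : OpenPartialHomeomorph S Plane}
    (ha : 0 < a) (ha1 : a ≤ 1) (ha' : 0 < a') (ha1' : a' ≤ 1)
    (h : IsHypChart a p r e) (h' : IsHypChart a' p' r' e') {x : S} (hx : x ∈ e.source)
    (hx' : x ∈ e'.source) : ContDiffAt ℝ ∞ (fun Y => e' (e.symm Y)) (e x) := by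
  obtain ⟨M, N', F, ε, hε, hM, hN', hMx, hF0, hF, hev⟩ :=
    exists_centered_transition ha ha1 ha' ha1' h h' hx hx'
  rw [← angleParam_eq_of_mem ha ha1 ha' ha1' h h' hx hx'] at hF
  obtain ⟨L, hL⟩ := exists_linear_of_hypDist_eq (angleParam_pos ha _) (angleParam_le_one ha1 _)
    hε hF0 hF
  have hF' : ContDiffAt ℝ ∞ F 0 :=
    L.contDiff.contDiffAt.congr_of_eventuallyEq
      (Filter.eventually_of_mem (Metric.ball_mem_nhds 0 hε) hL)
  refine ContDiffAt.congr_of_eventuallyEq ?_ hev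
  refine ContDiffAt.comp (g := N') (f := fun Y => F (M Y)) _ ?_
    (ContDiffAt.comp (g := F) _ ?_ hM)
  · rwa [hMx, hF0]
  · rwa [hMx]

/-- Changing polar to hyperboloid coordinates turns a chart at the apex of a cone into one in
hyperboloid coordinates. -/
lemma IsConeChart.isHypChart {θ r : ℝ} {p : S} {φ : OpenPartialHomeomorph S Plane}
    (h : IsConeChart θ p r φ) : IsHypChart (θ / (2 * Real.pi)) p r
      (φ.transHomeomorph sinhHomeo) where
  source_eq := h.source_eq
  target_eq := by
    ext X
    change X ∈ arsinhMap ⁻¹' φ.target ↔ _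
    rw [h.target_eq, Set.mem_preimage, mem_ball_zero_iff, mem_ball_zero_iff, norm_arsinhMap]
    conv_rhs => rw [← Real.sinh_arsinh ‖X‖, Real.sinh_lt_sinh]
  map_center := by
    change sinhMap (φ p) = 0
    rw [h.map_center, sinhMap_zero]
  dist_eq x hx y hy := (h.dist_eq x hx y hy).trans (coneDist_eq_hypDist θ _ _)

/-- The restriction of a chart to a smaller concentric ball is a chart. -/
lemma IsHypChart.restr {a r r' : ℝ} {p : S} {e : OpenPartialHomeomorph S Plane}
    (h : IsHypChart a p r e) (hr : r' ≤ r) :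
    IsHypChart a p r' (e.restrOpen (Metric.ball p r') Metric.isOpen_ball) where
  source_eq := by
    rw [e.restrOpen_source, h.source_eq, Set.inter_eq_right]
    exact Metric.ball_subset_ball hr
  target_eq := by
    ext X
    change X ∈ e.target ∧ e.symm X ∈ Metric.ball p r' ↔ _
    rw [h.target_eq, mem_ball_zero_iff, mem_ball_zero_iff]
    constructor
    · rintro ⟨h1, h2⟩
      have h3 : X ∈ e.target := by rwa [h.target_eq, mem_ball_zero_iff]
      rw [← e.right_inv h3, h.norm_eq (e.map_target h3), Real.sinh_lt_sinh, dist_comm]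
      exact h2
    · intro h1
      have h2 := h1.trans_le (Real.sinh_le_sinh.2 hr)
      have h3 : X ∈ e.target := by rwa [h.target_eq, mem_ball_zero_iff]
      refine ⟨h2, ?_⟩
      rwa [← e.right_inv h3, h.norm_eq (e.map_target h3), Real.sinh_lt_sinh, dist_comm] at h1
  map_center := h.map_center
  dist_eq x hx y hy :=
    h.dist_eq x (Metric.ball_subset_ball hr hx) y (Metric.ball_subset_ball hr hy)

end

/-! ### The infinitesimal form of the cone distance -/


/-- The squared length of the vector `V` at the point `X` of the hyperbolic cone of total angle
`2πa`, in hyperboloid coordinates. At the apex this is the squared norm, which gives the correct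
lengths of radial vectors. -/
def coneForm (a : ℝ) (X V : Plane) : ℝ :=
  if X = 0 then ‖V‖ ^ 2 else
    a ^ 2 * ‖V‖ ^ 2 + (1 / (1 + ‖X‖ ^ 2) - a ^ 2) * (inner ℝ X V / ‖X‖) ^ 2

lemma coneForm_smul (a : ℝ) (X V : Plane) (t : ℝ) :
    coneForm a X (t • V) = t ^ 2 * coneForm a X V := by
  unfold coneForm
  split_ifs
  · rw [norm_smul, mul_pow, Real.norm_eq_abs, sq_abs]
  · rw [norm_smul, mul_pow, Real.norm_eq_abs, sq_abs, inner_smul_right]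
    ring

lemma continuous_coneForm (a : ℝ) (X : Plane) : Continuous (coneForm a X) := by
  unfold coneForm
  split_ifs
  · fun_prop
  · have : Continuous fun V : Plane => inner ℝ X V := continuous_const.inner continuous_id
    fun_prop

lemma sq_inner_div_norm_le (X V : Plane) : (inner ℝ X V / ‖X‖) ^ 2 ≤ ‖V‖ ^ 2 := by
  rcases eq_or_ne X 0 with rfl | hX
  · simp
  rw [← sq_abs, abs_div, abs_norm]
  refine pow_le_pow_left₀ (by positivity) ?_ 2
  rw [div_le_iff₀ (norm_pos_iff.2 hX), mul_comm]
  exact abs_real_inner_le_norm X V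

lemma exists_mul_sq_norm_le_coneForm {a : ℝ} (ha : 0 < a) (X : Plane) :
    ∃ m : ℝ, 0 < m ∧ ∀ V, m * ‖V‖ ^ 2 ≤ coneForm a X V := by
  rcases eq_or_ne X 0 with rfl | hX
  · exact ⟨1, one_pos, fun V => by simp [coneForm]⟩
  refine ⟨min (a ^ 2) (1 / (1 + ‖X‖ ^ 2)), by positivity, fun V => ?_⟩
  rw [coneForm, if_neg hX]
  have h1 := min_le_left (a ^ 2) (1 / (1 + ‖X‖ ^ 2))
  have h2 := min_le_right (a ^ 2) (1 / (1 + ‖X‖ ^ 2))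
  have h3 := sq_inner_div_norm_le X V
  nlinarith [sq_nonneg (inner ℝ X V / ‖X‖)]

lemma one_sub_cos_eq (x : ℝ) : 1 - Real.cos x = Real.sinc (x / 2) ^ 2 * x ^ 2 / 2 := by
  have h1 : Real.sin (x / 2) = Real.sinc (x / 2) * (x / 2) := by
    rcases eq_or_ne x 0 with rfl | hx
    · simp
    · rw [Real.sinc_of_ne_zero (by positivity), div_mul_cancel₀ _ (by positivity)]
  have h2 := Real.cos_sq (x / 2)
  rw [mul_div_cancel₀ _ two_ne_zero, Real.cos_sq', h1] at h2
  linarith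

/-- The two parts of `cosh d - 1` on a cone: one due to the difference of the radii, and one due
to the angle. -/
lemma hypCosh_sub_one {a : ℝ} {X Y : Plane}
    (h : Real.sinc (InnerProductGeometry.angle X Y / 2) ≠ 0) :
    hypCosh a X Y - 1 = (‖Y‖ - ‖X‖) ^ 2 / (hypTime X * hypTime Y + 1 + ‖X‖ * ‖Y‖) +
      a ^ 2 * (Real.sinc (a * InnerProductGeometry.angle X Y / 2) ^ 2 /
        Real.sinc (InnerProductGeometry.angle X Y / 2) ^ 2) *
        ((‖Y - X‖ ^ 2 - (‖Y‖ - ‖X‖) ^ 2) / 2) := by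
  set t := InnerProductGeometry.angle X Y with ht
  have h1 : ‖Y - X‖ ^ 2 - (‖Y‖ - ‖X‖) ^ 2 = 2 * (‖X‖ * ‖Y‖) * (1 - Real.cos t) := by
    rw [norm_sub_sq_real, real_inner_comm, ← InnerProductGeometry.cos_angle_mul_norm_mul_norm]
    ring
  have h2 : (‖Y‖ - ‖X‖) ^ 2 / (hypTime X * hypTime Y + 1 + ‖X‖ * ‖Y‖) =
      hypTime X * hypTime Y - (1 + ‖X‖ * ‖Y‖) := by
    have hX := hypTime_pos X
    have hY := hypTime_pos Y
    have hX2 := hypTime_sq X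
    have hY2 := hypTime_sq Y
    rw [div_eq_iff (by positivity)]
    linear_combination (-‖Y‖^2 - 1) * hX2 - hypTime X ^ 2 * hY2
  have h3 : 1 - Real.cos (a * t) = a ^ 2 * (Real.sinc (a * t / 2) ^ 2 / Real.sinc (t / 2) ^ 2) *
      (1 - Real.cos t) := by
    rw [one_sub_cos_eq (a * t), one_sub_cos_eq t]
    field_simp
  rw [h1, h2, hypCosh, ← ht]
  linear_combination ‖X‖ * ‖Y‖ * h3

lemma tendsto_hypDist_self {a : ℝ} {X : Plane} : Tendsto (hypDist a X) (𝓝 X) (𝓝 0) := by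
  have h1 : Tendsto (hypCosh a X) (𝓝 X) (𝓝 1) := by
    rcases eq_or_ne X 0 with rfl | hX
    · have : hypCosh a 0 = hypTime := by funext Y; simp [hypCosh]
      rw [this]
      simpa using contDiff_hypTime.continuous.tendsto 0
    · have hang : ContinuousAt (fun Y : Plane => InnerProductGeometry.angle X Y) X :=
        (InnerProductGeometry.continuousAt_angle (x := (X, X)) hX hX).comp
          (continuousAt_const.prodMk continuousAt_id)
      have hc : ContinuousAt (hypCosh a X) X := by
        refine ContinuousAt.sub (continuousAt_const.mul contDiff_hypTime.continuous.continuousAt) ?_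
        exact (continuousAt_const.mul continuous_norm.continuousAt).mul
          (Real.continuous_cos.continuousAt.comp (continuousAt_const.mul hang))
      have : hypCosh a X X = 1 := by
        have := hypTime_sq X
        rw [hypCosh, InnerProductGeometry.angle_self hX, mul_zero, Real.cos_zero]
        linarith
      rw [← this]; exact hc
  have h2 : Tendsto Real.arcosh (𝓝[Set.Ici 1] 1) (𝓝 0) := by
    have := Real.continuousOn_arcosh 1 Set.self_mem_Ici
    rwa [ContinuousWithinAt, Real.arcosh_zero] at this
  exact h2.comp (tendsto_nhdsWithin_iff.2 ⟨h1, Eventually.of_forall fun Y => one_le_hypCosh a X Y⟩)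

/-- The first variation of the cone distance: near `X` it is given by `coneForm`. -/
theorem hypDist_sq_sub_coneForm_isLittleO {a : ℝ} (X : Plane) :
    (fun Y => hypDist a X Y ^ 2 - coneForm a X (Y - X)) =o[𝓝 X] fun Y => ‖Y - X‖ ^ 2 := by
  obtain ⟨f, hf, hf0, hfs⟩ := exists_contDiff_sinh_div
  -- `d² = μ(Y) · 2 (cosh d - 1)` with `μ → 1`
  have hμ : Tendsto (fun Y => 1 / f ((hypDist a X Y / 2) ^ 2) ^ 2) (𝓝 X) (𝓝 1) := by
    have h1 : Tendsto (fun Y => (hypDist a X Y / 2) ^ 2) (𝓝 X) (𝓝 0) := by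
      simpa using ((tendsto_hypDist_self (a := a) (X := X)).div_const 2).pow 2
    have h2 : Tendsto (fun s => 1 / f s ^ 2) (𝓝 0) (𝓝 1) := by
      have : ContinuousAt (fun s => 1 / f s ^ 2) 0 :=
        continuousAt_const.div (hf.continuous.continuousAt.pow 2) (by simp [hf0])
      simpa [ContinuousAt, hf0] using this
    exact h2.comp h1
  have hfne : ∀ x, f (x ^ 2) ≠ 0 := by
    intro x hx
    have := hfs x
    rw [hx, zero_mul, Real.sinh_eq_zero] at this
    subst this
    norm_num [hf0] at hx
  have hd : ∀ Y, hypDist a X Y ^ 2 =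
      1 / f ((hypDist a X Y / 2) ^ 2) ^ 2 * (2 * (hypCosh a X Y - 1)) := by
    intro Y
    have h1 := hfs (hypDist a X Y / 2)
    have h2 := Real.cosh_two_mul (hypDist a X Y / 2)
    rw [mul_div_cancel₀ _ two_ne_zero, Real.cosh_sq', cosh_hypDist, h1] at h2
    rw [h2]
    have := hfne (hypDist a X Y / 2)
    generalize f ((hypDist a X Y / 2) ^ 2) = c at *
    field_simp
    ring
  set μ := fun Y => 1 / f ((hypDist a X Y / 2) ^ 2) ^ 2 with hμdef
  have hsq : ∀ g : Plane → ℝ, ∀ c : ℝ, Tendsto g (𝓝 X) (𝓝 c) → ∀ w : Plane → ℝ,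
      w =O[𝓝 X] (fun Y => ‖Y - X‖ ^ 2) →
      (fun Y => (g Y - c) * w Y) =o[𝓝 X] fun Y => ‖Y - X‖ ^ 2 := by
    intro g c hg w hw
    have h1 : (fun Y => g Y - c) =o[𝓝 X] fun _ => (1 : ℝ) :=
      (isLittleO_one_iff ℝ).2 (by simpa using hg.sub_const c)
    simpa using h1.mul_isBigO hw
  -- at the apex only the radius matters
  rcases eq_or_ne X 0 with rfl | hX
  · have hT : ∀ Y : Plane, 2 * (hypCosh a 0 Y - 1) = 2 / (hypTime Y + 1) * ‖Y‖ ^ 2 := by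
      intro Y
      have h1 := hypTime_sq Y
      have h2 := hypTime_pos Y
      rw [hypCosh]
      simp
      field_simp
      linarith
    have hlim : Tendsto (fun Y => μ Y * (2 / (hypTime Y + 1))) (𝓝 0) (𝓝 1) := by
      have h1 : Tendsto (fun Y => 2 / (hypTime Y + 1)) (𝓝 0) (𝓝 1) := by
        have : ContinuousAt (fun Y => 2 / (hypTime Y + 1)) 0 :=
          continuousAt_const.div (contDiff_hypTime.continuous.continuousAt.add continuousAt_const)
            (by simp)
        simpa [ContinuousAt, one_add_one_eq_two] using this
      simpa using hμ.mul h1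
    refine (hsq _ 1 hlim (fun Y => ‖Y - 0‖ ^ 2) (isBigO_refl _ _)).congr_left fun Y => ?_
    rw [hd Y, hT Y, coneForm, if_pos rfl, sub_zero]
    ring
  have hang : ContinuousAt (fun Y : Plane => InnerProductGeometry.angle X Y) X :=
    (InnerProductGeometry.continuousAt_angle (x := (X, X)) hX hX).comp
      (continuousAt_const.prodMk continuousAt_id)
  have hang0 : Tendsto (fun Y : Plane => InnerProductGeometry.angle X Y) (𝓝 X) (𝓝 0) := by
    have := hang.tendsto
    rwa [InnerProductGeometry.angle_self hX] at this
  have hs1 : Tendsto (fun Y : Plane => Real.sinc (InnerProductGeometry.angle X Y / 2)) (𝓝 X)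
      (𝓝 1) := by
    have h1 : Tendsto (fun Y : Plane => InnerProductGeometry.angle X Y / 2) (𝓝 X) (𝓝 0) := by
      simpa using hang0.div_const 2
    have := (Real.continuous_sinc.tendsto 0).comp h1
    rwa [Real.sinc_zero] at this
  have hsa : Tendsto (fun Y : Plane => Real.sinc (a * InnerProductGeometry.angle X Y / 2)) (𝓝 X)
      (𝓝 1) := by
    have h1 : Tendsto (fun Y : Plane => a * InnerProductGeometry.angle X Y / 2) (𝓝 X) (𝓝 0) := by
      simpa using (hang0.const_mul a).div_const 2
    have := (Real.continuous_sinc.tendsto 0).comp h1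
    rwa [Real.sinc_zero] at this
  -- `2 (cosh d - 1) = k (‖Y‖ - ‖X‖)² + l (‖Y - X‖² - (‖Y‖ - ‖X‖)²)`, where `k` and `l` converge
  set l := fun Y : Plane => a ^ 2 * (Real.sinc (a * InnerProductGeometry.angle X Y / 2) ^ 2 /
        Real.sinc (InnerProductGeometry.angle X Y / 2) ^ 2) with hl
  have hllim : Tendsto l (𝓝 X) (𝓝 (a ^ 2)) := by
    simpa using ((hsa.pow 2).div (hs1.pow 2) (by simp)).const_mul (a ^ 2)
  set k := fun Y : Plane => 2 / (hypTime X * hypTime Y + 1 + ‖X‖ * ‖Y‖) with hk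
  have hklim : Tendsto k (𝓝 X) (𝓝 (1 / (1 + ‖X‖ ^ 2))) := by
    have hne : hypTime X * hypTime X + 1 + ‖X‖ * ‖X‖ ≠ 0 := by
      have := hypTime_pos X; positivity
    have : ContinuousAt k X :=
      continuousAt_const.div (((continuousAt_const.mul contDiff_hypTime.continuous.continuousAt).add
        continuousAt_const).add (continuousAt_const.mul continuous_norm.continuousAt)) hne
    have hval : k X = 1 / (1 + ‖X‖ ^ 2) := by
      simp only [hk]
      have := hypTime_sq X
      rw [div_eq_div_iff hne (by positivity)]
      linear_combination -this
    rw [← hval]; exact this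
  have hα : Tendsto (fun Y => μ Y * (k Y - l Y)) (𝓝 X) (𝓝 (1 / (1 + ‖X‖ ^ 2) - a ^ 2)) := by
    simpa using hμ.mul (hklim.sub hllim)
  have hβ : Tendsto (fun Y => μ Y * l Y) (𝓝 X) (𝓝 (a ^ 2)) := by
    simpa using hμ.mul hllim
  have hRT : (fun Y : Plane => ‖Y‖ - ‖X‖) =O[𝓝 X] fun Y => ‖Y - X‖ :=
    IsBigO.of_bound 1 (Eventually.of_forall fun Y => by
      rw [one_mul, norm_norm]; exact abs_norm_sub_norm_le Y X)
  have hin : (fun Y : Plane => inner ℝ X (Y - X) / ‖X‖) =O[𝓝 X] fun Y => ‖Y - X‖ :=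
    IsBigO.of_bound 1 (Eventually.of_forall fun Y => by
      rw [one_mul, norm_norm]
      exact abs_le_of_sq_le_sq (sq_inner_div_norm_le X (Y - X)) (norm_nonneg _))
  have hdiff : (fun Y : Plane => (‖Y‖ - ‖X‖) - inner ℝ X (Y - X) / ‖X‖) =o[𝓝 X]
      fun Y => ‖Y - X‖ := by
    have h1 : HasFDerivAt (fun Y : Plane => √(‖Y‖ ^ 2))
        ((1 / (2 * √(‖X‖ ^ 2))) • (2 • (innerSL ℝ X))) X :=
      (hasStrictFDerivAt_norm_sq X).hasFDerivAt.sqrt (by positivity)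
    have h2 := h1.isLittleO
    refine (h2.congr_left fun Y => ?_).norm_right
    simp only [Real.sqrt_sq (norm_nonneg _), FunLike.coe_smul, Pi.smul_apply,
      smul_eq_mul, nsmul_eq_mul]
    have : ‖X‖ ≠ 0 := norm_ne_zero_iff.2 hX
    rw [Nat.cast_ofNat]
    field_simp
    simp
    ring
  -- replace `k`, `l` by their limits, and `‖Y‖ - ‖X‖` by its differential
  have t1 := hsq _ _ hα (fun Y => (‖Y‖ - ‖X‖) ^ 2) (hRT.pow 2)
  have t2 := hsq _ _ hβ (fun Y => ‖Y - X‖ ^ 2) (isBigO_refl _ _)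
  have t3 : (fun Y : Plane => ((‖Y‖ - ‖X‖) - inner ℝ X (Y - X) / ‖X‖) *
      ((‖Y‖ - ‖X‖) + inner ℝ X (Y - X) / ‖X‖)) =o[𝓝 X] fun Y => ‖Y - X‖ ^ 2 :=
    (hdiff.mul_isBigO (hRT.add hin)).congr_right fun Y => by ring
  have hsinc : ∀ᶠ Y in 𝓝 X, Real.sinc (InnerProductGeometry.angle X Y / 2) ≠ 0 :=
    hs1.eventually_ne one_ne_zero
  refine ((t1.add t2).add (t3.const_mul_left (1 / (1 + ‖X‖ ^ 2) - a ^ 2))).congr' ?_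
    EventuallyEq.rfl
  filter_upwards [hsinc] with Y hY
  rw [hd Y, hypCosh_sub_one hY, coneForm, if_neg hX]
  simp only [hk, hl]
  ring

section

/-- The length of the velocity vector of a curve for `coneForm` is its speed for the cone
distance. -/
lemma tendsto_hypDist_sq_div {a : ℝ} {X V : Plane} {c : ℝ → Plane} {t : ℝ}
    (hc : HasDerivAt c V t) (hX : c t = X) :
    Tendsto (fun s => hypDist a X (c s) ^ 2 / (s - t) ^ 2) (𝓝[≠] t) (𝓝 (coneForm a X V)) := by
  have hct : Tendsto c (𝓝[≠] t) (𝓝 X) := by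
    rw [← hX]; exact hc.continuousAt.tendsto.mono_left nhdsWithin_le_nhds
  have h1 := (hypDist_sq_sub_coneForm_isLittleO (a := a) X).comp_tendsto hct
  have h2 : (fun s => ‖c s - X‖ ^ 2) =O[𝓝[≠] t] fun s => (s - t) ^ 2 := by
    have h := hc.isBigO_sub.mono (nhdsWithin_le_nhds (s := {t}ᶜ))
    rw [hX] at h
    exact h.norm_left.pow 2
  have h3 := (h1.trans_isBigO h2).tendsto_div_nhds_zero
  have h4 : Tendsto (fun s => coneForm a X ((s - t)⁻¹ • (c s - X))) (𝓝[≠] t)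
      (𝓝 (coneForm a X V)) := by
    refine ((continuous_coneForm a X).tendsto V).comp ?_
    have := hasDerivAt_iff_tendsto_slope.1 hc
    simpa only [slope_fun_def, vsub_eq_sub, hX] using this
  refine ((h3.add h4).congr' ?_).trans (by rw [zero_add])
  filter_upwards [self_mem_nhdsWithin] with s hs
  have hs' : s - t ≠ 0 := sub_ne_zero.2 hs
  rw [coneForm_smul]
  simp only [Function.comp]
  field_simp
  ring

lemma eventually_coneForm_le {a : ℝ} (ha : 0 < a) (X : Plane) {K : ℝ} (hK : 1 < K) :
    ∀ᶠ Y in 𝓝 X, coneForm a X (Y - X) ≤ K * hypDist a X Y ^ 2 := by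
  obtain ⟨m, hm, hmV⟩ := exists_mul_sq_norm_le_coneForm ha X
  have h1 : 0 < m * (1 - K⁻¹) := mul_pos hm (by rw [sub_pos]; exact inv_lt_one_of_one_lt₀ hK)
  filter_upwards [(hypDist_sq_sub_coneForm_isLittleO (a := a) X).bound h1] with Y hY
  rw [norm_pow, norm_norm, Real.norm_eq_abs, abs_le] at hY
  have h2 := hmV (Y - X)
  have h3 : 0 ≤ 1 - K⁻¹ := by rw [sub_nonneg]; exact (inv_lt_one_of_one_lt₀ hK).le
  have h4 : K⁻¹ * coneForm a X (Y - X) ≤ hypDist a X Y ^ 2 := by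
    nlinarith [mul_le_mul_of_nonneg_left h2 h3]
  rwa [inv_mul_le_iff₀ (by linarith)] at h4

variable {S : Type*} [MetricSpace S]

/-- The transition maps are isometries of the infinitesimal cone metrics. -/
theorem coneForm_transition {a a' r r' : ℝ} {p p' : S} {e e' : OpenPartialHomeomorph S Plane}
    (ha : 0 < a) (ha1 : a ≤ 1) (ha' : 0 < a') (ha1' : a' ≤ 1)
    (h : IsHypChart a p r e) (h' : IsHypChart a' p' r' e') {x : S} (hx : x ∈ e.source)
    (hx' : x ∈ e'.source) (V : Plane) :
    coneForm a' (e' x) (fderiv ℝ (fun Y => e' (e.symm Y)) (e x) V) = coneForm a (e x) V := by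
  have hd := ((contDiffAt_transition ha ha1 ha' ha1' h h' hx hx').differentiableAt
    (by simp)).hasFDerivAt
  have hline : HasDerivAt (fun t : ℝ => e x + t • V) V 0 := by
    simpa using ((hasDerivAt_id (0 : ℝ)).smul_const V).const_add (e x)
  have hline' : HasDerivAt (fun t : ℝ => e' (e.symm (e x + t • V)))
      (fderiv ℝ (fun Y => e' (e.symm Y)) (e x) V) 0 :=
    HasFDerivAt.comp_hasDerivAt (l := fun Y => e' (e.symm Y)) (f := fun t : ℝ => e x + t • V) 0
      (by simpa using hd) hline
  refine tendsto_nhds_unique (tendsto_hypDist_sq_div hline' (by simp [e.left_inv hx]))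
    ((tendsto_hypDist_sq_div hline (by simp)).congr' ?_)
  have hsrc : ∀ᶠ Y in 𝓝 (e x), Y ∈ e.target ∧ e.symm Y ∈ e'.source := by
    refine (e.open_target.eventually_mem (e.map_source hx)).and ?_
    refine (e.continuousAt_symm (e.map_source hx)).eventually ?_
    rw [e.left_inv hx]
    exact e'.open_source.eventually_mem hx'
  have hlim : Tendsto (fun t : ℝ => e x + t • V) (𝓝[≠] 0) (𝓝 (e x)) := by
    simpa using hline.continuousAt.tendsto.mono_left nhdsWithin_le_nhds
  filter_upwards [hlim.eventually hsrc] with t ht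
  rw [← h'.dist_eq_of_mem hx' ht.2, h.dist_eq_of_mem hx (e.map_target ht.1), e.right_inv ht.1]

/-! ### Smoothing the apex of a cone -/

/-- A smooth cutoff function of the squared radius, equal to `1` near `0` and to `0` for
`s ≥ 1`, and nonincreasing. -/
def capCutoff (s : ℝ) : ℝ := 1 - Real.smoothTransition (2 * s - 1)

lemma contDiff_capCutoff : ContDiff ℝ ∞ capCutoff :=
  contDiff_const.sub (Real.smoothTransition.contDiff.comp
    ((contDiff_const.mul contDiff_id).sub contDiff_const))

lemma capCutoff_of_le {s : ℝ} (hs : s ≤ 1 / 2) : capCutoff s = 1 := by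
  rw [capCutoff, Real.smoothTransition.zero_of_nonpos (by linarith), sub_zero]

lemma capCutoff_of_ge {s : ℝ} (hs : 1 ≤ s) : capCutoff s = 0 := by
  rw [capCutoff, Real.smoothTransition.one_of_one_le (by linarith), sub_self]

lemma capCutoff_nonneg (s : ℝ) : 0 ≤ capCutoff s :=
  sub_nonneg.2 (Real.smoothTransition.le_one _)

lemma deriv_capCutoff_nonpos (s : ℝ) : deriv capCutoff s ≤ 0 := by
  refine Antitone.deriv_nonpos (fun x y hxy => ?_)
  exact sub_le_sub_left (Real.smoothTransition.monotone (by linarith)) _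

/-- The reciprocal of the squared length of the radial unit vector in the smoothed cone of total
angle `2πa`; the unsmoothed cone has `1 + s`, and a smooth apex needs the value `1 / a²` at
`s = 0`. The parameter `κ` is the value of `s` beyond which the cone is unchanged. -/
def capInvSq (a κ s : ℝ) : ℝ := 1 + s + (1 / a ^ 2 - 1) * capCutoff (s / κ)

/-- The coefficient of `⟨X, dX⟩²` in the smoothed cone metric. Since the cutoff function is `1` near
`0`, the quotient by `s` is smooth there, with the value `0` that division by zero gives. -/
def capCoeff (a κ s : ℝ) : ℝ :=
  ((1 - a ^ 2) * ((1 - capCutoff (s / κ)) / s) - a ^ 2) / capInvSq a κ s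

lemma inv_sq_sub_one_nonneg {a : ℝ} (ha : 0 < a) (ha1 : a ≤ 1) : 0 ≤ 1 / a ^ 2 - 1 := by
  rw [sub_nonneg, le_div_iff₀ (by positivity), one_mul]
  exact pow_le_one₀ ha.le ha1

lemma one_add_le_capInvSq {a : ℝ} (ha : 0 < a) (ha1 : a ≤ 1) (κ s : ℝ) :
    1 + s ≤ capInvSq a κ s :=
  le_add_of_nonneg_right (mul_nonneg (inv_sq_sub_one_nonneg ha ha1) (capCutoff_nonneg _))

lemma capInvSq_pos {a : ℝ} (ha : 0 < a) (ha1 : a ≤ 1) (κ : ℝ) {s : ℝ} (hs : 0 ≤ s) :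
    0 < capInvSq a κ s := by linarith [one_add_le_capInvSq ha ha1 κ s]

lemma contDiff_capInvSq (a κ : ℝ) : ContDiff ℝ ∞ (capInvSq a κ) :=
  (contDiff_const.add contDiff_id).add
    (contDiff_const.mul (contDiff_capCutoff.comp (contDiff_id.div_const κ)))

lemma contDiffAt_capCoeff {a κ s : ℝ} (ha : 0 < a) (ha1 : a ≤ 1) (hκ : 0 < κ) (hs : 0 ≤ s) :
    ContDiffAt ℝ ∞ (capCoeff a κ) s := by
  refine ContDiffAt.div ?_ (contDiff_capInvSq a κ).contDiffAt (capInvSq_pos ha ha1 κ hs).ne'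
  refine ContDiffAt.sub (contDiffAt_const.mul ?_) contDiffAt_const
  rcases hs.eq_or_lt with rfl | hs
  · refine (contDiffAt_const (c := (0 : ℝ))).congr_of_eventuallyEq ?_
    filter_upwards [gt_mem_nhds (show (0 : ℝ) < κ / 2 by positivity)] with t ht
    rw [capCutoff_of_le (by rw [div_le_iff₀ hκ]; linarith), sub_self, zero_div]
  · exact (contDiffAt_const.sub (contDiff_capCutoff.comp (contDiff_id.div_const κ)).contDiffAt).div
      contDiffAt_id hs.ne'

/-- The squared length of the radial unit vector in the smoothed cone metric. -/
lemma sq_add_mul_capCoeff {a κ s : ℝ} (ha : 0 < a) (hu : capInvSq a κ s ≠ 0) :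
    a ^ 2 + s * capCoeff a κ s = 1 / capInvSq a κ s := by
  have h1 : a ^ 2 * capInvSq a κ s + s * ((1 - a ^ 2) * ((1 - capCutoff (s / κ)) / s) - a ^ 2) =
      1 := by
    rcases eq_or_ne s 0 with rfl | hs
    · rw [capInvSq, zero_div, capCutoff_of_le (by norm_num)]
      field_simp
      ring
    · rw [capInvSq]
      field_simp
      ring
  rw [capCoeff, eq_div_iff hu, add_mul, mul_assoc, div_mul_cancel₀ _ hu, h1]

/-- Where the cone is not changed, and everywhere if it has no singularity, the coefficient is the
one of the cone metric. -/
lemma capCoeff_eq {a κ s : ℝ} (hs : 0 < s) (h : a = 1 ∨ κ ≤ s) (hκ : 0 < κ) :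
    capCoeff a κ s = (1 / (1 + s) - a ^ 2) / s := by
  have hs1 : 1 + s ≠ 0 := by positivity
  rw [capCoeff, capInvSq]
  rcases h with rfl | h
  · norm_num
    field_simp
    ring
  · rw [capCutoff_of_ge (by rwa [one_le_div hκ]), mul_zero, add_zero,
      div_eq_div_iff hs1 hs.ne', sub_zero]
    linear_combination (1 - a ^ 2) * one_div_mul_cancel hs.ne' - one_div_mul_cancel hs1

lemma capCoeff_le {a κ s : ℝ} (ha : 0 < a) (ha1 : a ≤ 1) (hs : 0 < s) :
    capCoeff a κ s ≤ (1 / (1 + s) - a ^ 2) / s := by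
  have h1 := capInvSq_pos ha ha1 κ hs.le
  rw [le_div_iff₀ hs, mul_comm, le_sub_iff_add_le', sq_add_mul_capCoeff ha h1.ne']
  exact one_div_le_one_div_of_le (by linarith) (one_add_le_capInvSq ha ha1 κ s)

/-- The inner product of the plane as a continuous bilinear form. -/
def planeInner : Plane →L[ℝ] Plane →L[ℝ] ℝ := innerSL ℝ

@[simp] lemma planeInner_apply (V W : Plane) : planeInner V W = inner ℝ V W := rfl

/-- The smoothed cone metric, multiplied by `c`, at the point `X`. -/
def capBilin (a κ c : ℝ) (X : Plane) : Plane →L[ℝ] Plane →L[ℝ] ℝ :=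
  (c * a ^ 2) • planeInner + (c * capCoeff a κ (‖X‖ ^ 2)) •
    (planeInner X).smulRight (planeInner X)

lemma capBilin_apply (a κ c : ℝ) (X V W : Plane) : capBilin a κ c X V W =
    c * a ^ 2 * inner ℝ V W + c * capCoeff a κ (‖X‖ ^ 2) * (inner ℝ X V * inner ℝ X W) := by
  simp [capBilin]

lemma capBilin_symm (a κ c : ℝ) (X V W : Plane) : capBilin a κ c X V W = capBilin a κ c X W V := by
  rw [capBilin_apply, capBilin_apply, real_inner_comm, mul_comm (inner ℝ X V)]

/-- Smoothness of a product with a scalar. The statement for variable spaces lets unification find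
the instances for spaces of bilinear forms, where instance search does not. -/
lemma contDiff_smul_of_normedSpace {F G : Type*} [NormedAddCommGroup F] [NormedSpace ℝ F]
    [NormedAddCommGroup G] [NormedSpace ℝ G] {g : F → ℝ} (hg : ContDiff ℝ ∞ g) {L : F → G}
    (hL : ContDiff ℝ ∞ L) : ContDiff ℝ ∞ (fun x => g x • L x) := hg.smul hL

set_option synthInstance.maxHeartbeats 400000 in
lemma contDiff_capBilin {a κ : ℝ} (ha : 0 < a) (ha1 : a ≤ 1) (hκ : 0 < κ) (c : ℝ) :
    ContDiff ℝ ∞ (capBilin a κ c) := by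
  have h1 : ContDiff ℝ ∞ fun X : Plane => capCoeff a κ (‖X‖ ^ 2) :=
    contDiff_iff_contDiffAt.2 fun X => ContDiffAt.comp (g := capCoeff a κ) X
      (contDiffAt_capCoeff ha ha1 hκ (sq_nonneg _)) (contDiff_norm_sq ℝ).contDiffAt
  refine contDiff_const.add (contDiff_smul_of_normedSpace (contDiff_const.mul h1) ?_)
  exact (planeInner).contDiff.smulRight (planeInner).contDiff

lemma capBilin_self (a κ c : ℝ) (X V : Plane) : capBilin a κ c X V V =
    c * (a ^ 2 * ‖V‖ ^ 2 + capCoeff a κ (‖X‖ ^ 2) * (inner ℝ X V) ^ 2) := by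
  rw [capBilin_apply, real_inner_self_eq_norm_sq]; ring

/-- Where the cone is not changed, the metric is `c` times the cone metric. -/
lemma capBilin_self_eq {a κ : ℝ} (c : ℝ) {X : Plane} (hκ : 0 < κ) (h : a = 1 ∨ κ ≤ ‖X‖ ^ 2)
    (V : Plane) : capBilin a κ c X V V = c * coneForm a X V := by
  rw [capBilin_self, coneForm]
  split_ifs with hX
  · rcases h with rfl | h
    · simp [hX]
    · simp [hX] at h; linarith
  · rw [capCoeff_eq (by positivity) h hκ, div_pow]
    congr 2
    have : ‖X‖ ≠ 0 := norm_ne_zero_iff.2 hX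
    field_simp

/-- The smoothing does not increase lengths. -/
lemma capBilin_self_le {a κ c : ℝ} (ha : 0 < a) (ha1 : a ≤ 1) (hc : 0 ≤ c)
    (X V : Plane) : capBilin a κ c X V V ≤ c * coneForm a X V := by
  rw [capBilin_self, coneForm]
  refine mul_le_mul_of_nonneg_left ?_ hc
  split_ifs with hX
  · simp only [hX, inner_zero_left]
    nlinarith [sq_nonneg ‖V‖, pow_le_one₀ ha.le ha1 (n := 2)]
  · have h1 := mul_le_mul_of_nonneg_right
      (capCoeff_le (κ := κ) ha ha1 (s := ‖X‖ ^ 2) (by positivity))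
      (sq_nonneg (inner ℝ X V))
    have h2 : (1 / (1 + ‖X‖ ^ 2) - a ^ 2) / ‖X‖ ^ 2 * inner ℝ X V ^ 2 =
        (1 / (1 + ‖X‖ ^ 2) - a ^ 2) * (inner ℝ X V / ‖X‖) ^ 2 := by
      rw [div_pow]; ring
    linarith

lemma exists_mul_sq_norm_le_capBilin {a κ c : ℝ} (ha : 0 < a) (ha1 : a ≤ 1) (hc : 0 < c)
    (X : Plane) : ∃ m : ℝ, 0 < m ∧ ∀ V, m * ‖V‖ ^ 2 ≤ capBilin a κ c X V V := by
  have hu := capInvSq_pos ha ha1 κ (sq_nonneg ‖X‖)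
  refine ⟨c * min (a ^ 2) (1 / capInvSq a κ (‖X‖ ^ 2)), by positivity, fun V => ?_⟩
  rw [capBilin_self, mul_assoc]
  refine mul_le_mul_of_nonneg_left ?_ hc.le
  have h1 := min_le_left (a ^ 2) (1 / capInvSq a κ (‖X‖ ^ 2))
  have h2 := min_le_right (a ^ 2) (1 / capInvSq a κ (‖X‖ ^ 2))
  have h3 := sq_inner_div_norm_le X V
  have h4 := sq_add_mul_capCoeff ha hu.ne'
  have h5 : capCoeff a κ (‖X‖ ^ 2) * inner ℝ X V ^ 2 =
      (1 / capInvSq a κ (‖X‖ ^ 2) - a ^ 2) * (inner ℝ X V / ‖X‖) ^ 2 := by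
    rw [← h4]
    rcases eq_or_ne X 0 with rfl | hX
    · simp
    · have : ‖X‖ ≠ 0 := norm_ne_zero_iff.2 hX
      field_simp
      ring
  rw [h5]
  nlinarith [sq_nonneg (inner ℝ X V / ‖X‖)]

lemma capBilin_single (a κ c : ℝ) (X : Plane) (i j : Fin 2) :
    capBilin a κ c X (EuclideanSpace.single i 1) (EuclideanSpace.single j 1) =
      radialMatrix (c * a ^ 2) (fun s => c * capCoeff a κ s) X i j := by
  rw [capBilin_apply, radialMatrix, Matrix.of_apply]
  simp [EuclideanSpace.inner_single_right, PiLp.single_apply, eq_comm]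

/-- The smoothed cone has curvature at least `-1`, and multiplying the metric by `c > 1` makes the
inequality strict. -/
theorem neg_one_lt_planeCurvature_capBilin {a κ c : ℝ} (ha : 0 < a) (ha1 : a ≤ 1) (hκ : 0 < κ)
    (hc : 1 < c) {G : Plane → Matrix (Fin 2) (Fin 2) ℝ} {u : Plane}
    (hG : ∀ᶠ X in 𝓝 u, ∀ i j, G X i j =
      capBilin a κ c X (EuclideanSpace.single i 1) (EuclideanSpace.single j 1)) :
    -1 < planeCurvature G u := by
  have hc0 : 0 < c := by linarith
  have hG' : G =ᶠ[𝓝 u] radialMatrix (c * a ^ 2) (fun s => c * capCoeff a κ s) := by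
    filter_upwards [hG] with X hX
    ext i j
    rw [hX, capBilin_single]
  set s := ‖u‖ ^ 2 with hs
  have hs0 : 0 ≤ s := sq_nonneg _
  have hu := capInvSq_pos ha ha1 κ hs0
  have hq := sq_add_mul_capCoeff ha hu.ne'
  have hq' : c * a ^ 2 + s * (c * capCoeff a κ s) = c * (1 / capInvSq a κ s) := by rw [← hq]; ring
  have hBd : DifferentiableAt ℝ (capCoeff a κ) s :=
    (contDiffAt_capCoeff ha ha1 hκ hs0).differentiableAt (by simp)
  -- the derivative of the identity `a² + s B = 1 / u`, where `u` is `capInvSq`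
  have hder : capCoeff a κ s + s * deriv (capCoeff a κ) s =
      -deriv (capInvSq a κ) s / capInvSq a κ s ^ 2 := by
    have h1 := ((hasDerivAt_id s).mul hBd.hasDerivAt).const_add (a ^ 2)
    have h2 := ((contDiff_capInvSq a κ).differentiable (by simp) s).hasDerivAt.inv hu.ne'
    have h3 : (fun t => a ^ 2 + (id * capCoeff a κ : ℝ → ℝ) t) =ᶠ[𝓝 s] (capInvSq a κ)⁻¹ := by
      filter_upwards [(contDiff_capInvSq a κ).continuous.continuousAt.eventually_ne hu.ne']
        with t ht
      simpa using sq_add_mul_capCoeff ha ht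
    have h4 := h1.unique (h2.congr_of_eventuallyEq h3)
    simpa using h4
  have hu' : deriv (capInvSq a κ) s ≤ 1 := by
    have h1 : HasDerivAt (capInvSq a κ)
        (1 + (1 / a ^ 2 - 1) * (deriv capCutoff (s / κ) * (1 / κ))) s := by
      have h2 := ((contDiff_capCutoff.differentiable (by simp) (s / κ)).hasDerivAt).comp s
        ((hasDerivAt_id s).div_const κ)
      exact ((hasDerivAt_id s).const_add 1).add (h2.const_mul _)
    rw [h1.deriv]
    have h2 := mul_nonneg (inv_sq_sub_one_nonneg ha ha1) (mul_nonneg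
      (neg_nonneg.2 (deriv_capCutoff_nonpos (s / κ))) (one_div_pos.2 hκ).le)
    linarith
  rw [planeCurvature_radialMatrix (fun t ht => contDiffAt_const.mul
    (contDiffAt_capCoeff ha ha1 hκ ht)) hG' (by positivity) (by rw [← hs, hq']; positivity),
    ← hs, hq', deriv_const_mul _ hBd]
  rw [show c * capCoeff a κ s + s * (c * deriv (capCoeff a κ) s) =
    c * (capCoeff a κ s + s * deriv (capCoeff a κ) s) by ring, hder]
  have : c * (-deriv (capInvSq a κ) s / capInvSq a κ s ^ 2) / (c * (1 / capInvSq a κ s)) ^ 2 =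
    -deriv (capInvSq a κ) s / c := by field_simp
  rw [this, lt_div_iff₀ hc0]
  linarith

end

section

/-! ### An atlas adapted to the singularities -/

/-- A choice of a cone chart around each point, such that two charts are equal, or overlap only
away from their singularities. The chart at `x` is centered at `center x`, with cone angle
`2π * angle x`; the centre is singular if `angle x < 1`. -/
structure ConeAtlas (S : Type*) [MetricSpace S] where
  /-- The centre of the chart around a point. -/
  center : S → S
  /-- The cone angle at the centre, divided by `2π`. -/
  angle : S → ℝ
  /-- The radius of the domain of the chart. -/
  radius : S → ℝ
  /-- The chart around a point, in hyperboloid coordinates. -/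
  chart : S → OpenPartialHomeomorph S Plane
  /-- A lower bound for the distances between singularities, and from a singularity to the overlaps
  of its charts with other ones. -/
  gap : ℝ
  gap_pos : 0 < gap
  angle_pos : ∀ x, 0 < angle x
  angle_le_one : ∀ x, angle x ≤ 1
  isHypChart : ∀ x, IsHypChart (angle x) (center x) (radius x) (chart x)
  mem_source : ∀ x, x ∈ (chart x).source
  overlap : ∀ x y z, z ∈ (chart x).source → z ∈ (chart y).source →
    (chart x = chart y ∧ angle x = angle y) ∨
      ((angle x = 1 ∨ gap ≤ dist (center x) z) ∧ (angle y = 1 ∨ gap ≤ dist (center y) z))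
  gap_le_dist : ∀ x y, angle x < 1 → angle y < 1 → center x ≠ center y →
    gap ≤ dist (center x) (center y)

variable {S : Type*} [MetricSpace S]

lemma IsHyperbolicPolyhedral.exists_isHypChart (hS : IsHyperbolicPolyhedral S) (p : S) :
    ∃ (a r : ℝ) (e : OpenPartialHomeomorph S Plane), 0 < a ∧ a ≤ 1 ∧ 0 < r ∧
      IsHypChart a p r e := by
  obtain ⟨θ, hθ, hθ', r, hr, φ, hφ⟩ := hS.exists_coneChart p
  exact ⟨_, r, _, by positivity, (div_le_one (by positivity)).2 hθ', hr, hφ.isHypChart⟩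

/-- Points near a singularity get the chart centered there, and all other points get a chart
centered at themselves that is too small to come close to a singularity. By compactness, the sizes
can be chosen uniformly. -/
theorem IsHyperbolicPolyhedral.nonempty_coneAtlas [CompactSpace S]
    (hS : IsHyperbolicPolyhedral S) : Nonempty (ConeAtlas S) := by
  classical
  choose a r e ha ha1 hr he using hS.exists_isHypChart
  obtain ⟨ε, hε, hcov⟩ := lebesgue_number_lemma_of_metric (s := Set.univ)
    (c := fun p => Metric.ball p (r p)) isCompact_univ (fun _ => Metric.isOpen_ball)
    (fun p _ => Set.mem_iUnion.2 ⟨p, Metric.mem_ball_self (hr p)⟩)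
  have hmem : ∀ p, p ∈ (e p).source := fun p => by
    rw [(he p).source_eq]; exact Metric.mem_ball_self (hr p)
  have hsing : ∀ p q, a p < 1 → p ∈ Metric.ball q (r q) → p = q := fun p q hp hpq =>
    (he p).eq_center_of_singular (ha p) hp (ha q) (ha1 q) (he q) (hmem p)
      (by rwa [(he q).source_eq])
  have hball : ∀ p, a p < 1 → Metric.ball p ε ⊆ Metric.ball p (r p) := fun p hp => by
    obtain ⟨q, hq⟩ := hcov p trivial
    rwa [← hsing p q hp (hq (Metric.mem_ball_self hε))] at hq
  have hsep : ∀ p q, a p < 1 → a q < 1 → dist q p < ε → p = q := fun p q hp hq hpq =>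
    (hsing q p hq (hball p hp hpq)).symm
  -- `ε` bounds from below the distance of two singularities; a point is close to one of them if
  -- its distance is less than `ε / 2`
  let sing : S → Prop := fun x => ∃ p, a p < 1 ∧ dist x p < ε / 2
  let c : S → S := fun x => if h : sing x then h.choose else x
  let R : S → ℝ := fun p => if a p < 1 then min (r p) (ε / 2) else min (r p) (ε / 4)
  have hR : ∀ p, R p ≤ r p := fun p => by
    simp only [R]; split_ifs <;> exact min_le_left _ _
  have hc : ∀ x, (a (c x) < 1 ∧ dist x (c x) < ε / 2) ∨
      (c x = x ∧ a x = 1 ∧ ∀ p, a p < 1 → ε / 2 ≤ dist x p) := by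
    intro x
    by_cases h : sing x
    · left; simp only [c, dif_pos h]; exact h.choose_spec
    · right
      refine ⟨dif_neg h, le_antisymm (ha1 x) (not_lt.1 fun hx => h ⟨x, hx, ?_⟩), fun p hp => ?_⟩
      · rw [dist_self]; positivity
      · exact not_lt.1 fun hx => h ⟨p, hp, hx⟩
  have hsrc : ∀ p, ((e p).restrOpen (Metric.ball p (R p)) Metric.isOpen_ball).source =
      Metric.ball p (R p) := fun p => ((he p).restr (hR p)).source_eq
  refine ⟨⟨c, fun x => a (c x), fun x => R (c x),
    fun x => (e (c x)).restrOpen (Metric.ball (c x) (R (c x))) Metric.isOpen_ball, ε / 4,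
    by positivity, fun x => ha _, fun x => ha1 _, fun x => (he _).restr (hR _), ?_, ?_, ?_⟩⟩
  · intro x
    rw [hsrc, Metric.mem_ball]
    rcases hc x with ⟨h1, h2⟩ | ⟨h1, h2, -⟩
    · simp only [R, if_pos h1]
      exact lt_min (hball _ h1 (Metric.mem_ball.2 (by linarith))) h2
    · rw [h1, dist_self]
      simp only [R, h2, lt_irrefl, if_false]
      exact lt_min (hr x) (by positivity)
  · intro x y z hx hy
    rw [hsrc, Metric.mem_ball] at hx hy
    have hs : ∀ p, a p < 1 → dist z p < R p → dist z p < ε / 2 := fun p hp h => by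
      simp only [R, if_pos hp] at h
      exact h.trans_le (min_le_right _ _)
    have hs' : ∀ p, a p = 1 → dist z p < R p → dist z p < ε / 4 := fun p hp h => by
      simp only [R, hp, lt_irrefl, if_false] at h
      exact h.trans_le (min_le_right _ _)
    -- a regular chart stays away from the singularities
    have key : ∀ x y, dist z (c x) < R (c x) → dist z (c y) < R (c y) → a (c x) < 1 →
        c y = y ∧ a y = 1 ∧ (∀ p, a p < 1 → ε / 2 ≤ dist y p) → ε / 4 ≤ dist (c x) z := by
      rintro x y hx hy h1 ⟨k1, k2, k3⟩
      have h2 := k3 _ h1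
      rw [k1] at hy
      have h3 := hs' y k2 hy
      have h4 := dist_triangle_left y (c x) z
      rw [dist_comm (c x)]
      linarith
    rcases hc x with ⟨h1, h2⟩ | h1 <;> rcases hc y with ⟨k1, k2⟩ | k1
    · left
      have : c x = c y := hsep _ _ h1 k1 (by
        have := dist_triangle_left (c y) (c x) z
        linarith [hs _ h1 hx, hs _ k1 hy])
      rw [this]
      exact ⟨rfl, rfl⟩
    · exact Or.inr ⟨Or.inr (key x y hx hy h1 k1), Or.inl (by rw [k1.1, k1.2.1])⟩
    · exact Or.inr ⟨Or.inl (by rw [h1.1, h1.2.1]), Or.inr (key y x hy hx k1 h1)⟩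
    · exact Or.inr ⟨Or.inl (by rw [h1.1, h1.2.1]), Or.inl (by rw [k1.1, k1.2.1])⟩
  · intro x y hx hy hne
    by_contra! h
    exact hne (hsep _ _ hx hy (by rw [dist_comm]; linarith))

/-! ### The smooth structure -/

namespace ConeAtlas

/-- The smooth structure given by the charts of a cone atlas. Its atlas consists of all the cone
charts, in polar and in hyperboloid coordinates. -/
@[reducible] def chartedSpace (A : ConeAtlas S) : ChartedSpace Plane S where
  atlas := {e | ∃ a p r, 0 < a ∧ a ≤ 1 ∧
    (IsHypChart a p r e ∨ IsHypChart a p r (e.transHomeomorph sinhHomeo))}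
  chartAt := A.chart
  mem_chart_source := A.mem_source
  chart_mem_atlas x := ⟨_, _, _, A.angle_pos x, A.angle_le_one x, Or.inl (A.isHypChart x)⟩

lemma isManifold (A : ConeAtlas S) :
    letI := A.chartedSpace
    IsManifold 𝓘(ℝ, Plane) ∞ S := by
  let _ := A.chartedSpace
  refine isManifold_of_contDiffOn _ _ _ ?_
  rintro e e' ⟨a, p, r, ha, ha1, he⟩ ⟨a', p', r', ha', ha1', he'⟩
  -- every chart is a hyperboloid chart followed by a diffeomorphism of the plane
  have key : ∀ {a p r} {e : OpenPartialHomeomorph S Plane},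
      (IsHypChart a p r e ∨ IsHypChart a p r (e.transHomeomorph sinhHomeo)) →
      ∃ (E : OpenPartialHomeomorph S Plane) (f g : Plane → Plane), ContDiff ℝ ∞ f ∧
        ContDiff ℝ ∞ g ∧ IsHypChart a p r E ∧ E.source = e.source ∧
        (∀ x, e x = f (E x)) ∧ ∀ X, e.symm X = E.symm (g X) ∧
          (X ∈ e.target → g X = E (e.symm X)) := by
    rintro a p r e (h | h)
    · exact ⟨e, id, id, contDiff_id, contDiff_id, h, rfl, fun _ => rfl, fun X =>
        ⟨rfl, fun hX => (e.right_inv hX).symm⟩⟩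
    · refine ⟨e.transHomeomorph sinhHomeo, arsinhMap, sinhMap, contDiff_arsinhMap,
        contDiff_sinhMap, h, rfl, fun x => (arsinhMap_sinhMap _).symm, fun X => ?_⟩
      have h1 : e.symm X = (e.transHomeomorph sinhHomeo).symm (sinhMap X) :=
        congrArg e.symm (arsinhMap_sinhMap X).symm
      refine ⟨h1, fun hX => ?_⟩
      change sinhMap X = sinhMap (e (e.symm X))
      rw [e.right_inv hX]
  obtain ⟨E, f, g, hf, hg, hE, hEs, hEe, hEs'⟩ := key he
  obtain ⟨E', f', g', hf', hg', hE', hEs2, hEe2, -⟩ := key he'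
  intro X hX
  simp only [modelWithCornersSelf_coe, modelWithCornersSelf_coe_symm, Set.range_id, Set.inter_univ,
    Set.preimage_id, OpenPartialHomeomorph.trans_source, OpenPartialHomeomorph.symm_source,
    Set.mem_inter_iff, Set.mem_preimage] at hX
  have h1 := contDiffAt_transition ha ha1 ha' ha1' hE hE' (x := e.symm X)
    (by rw [hEs]; exact e.map_target hX.1) (by rw [hEs2]; exact hX.2)
  rw [← (hEs' X).2 hX.1] at h1
  have h2 : ContDiffAt ℝ ∞ (fun Y => f' (E' (E.symm (g Y)))) X :=
    hf'.contDiffAt.comp X (ContDiffAt.comp (g := fun Y => E' (E.symm Y)) X h1 hg.contDiffAt)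
  refine ContDiffAt.contDiffWithinAt (h2.congr_of_eventuallyEq (Eventually.of_forall fun Y => ?_))
  change e' (e.symm Y) = _
  rw [hEe2, (hEs' Y).1]

lemma mem_maximalAtlas (A : ConeAtlas S) {θ r : ℝ} {p : S} {φ : OpenPartialHomeomorph S Plane}
    (hθ : 0 < θ) (hθ' : θ ≤ 2 * Real.pi) (hφ : IsConeChart θ p r φ) :
    letI := A.chartedSpace
    φ ∈ IsManifold.maximalAtlas 𝓘(ℝ, Plane) ∞ S := by
  let _ := A.chartedSpace
  have := A.isManifold
  exact IsManifold.subset_maximalAtlas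
    ⟨_, p, r, by positivity, (div_le_one (by positivity)).2 hθ', Or.inr hφ.isHypChart⟩

end ConeAtlas

end

section

/-! ### The smoothed metrics -/

lemma capBilin_self_pos {a κ c : ℝ} (ha : 0 < a) (ha1 : a ≤ 1) (hc : 0 < c) (X : Plane) {V : Plane}
    (hV : V ≠ 0) : 0 < capBilin a κ c X V V := by
  obtain ⟨m, hm, h⟩ := exists_mul_sq_norm_le_capBilin (κ := κ) ha ha1 hc X
  have hV' : 0 < ‖V‖ := norm_pos_iff.2 hV
  exact (by positivity : 0 < m * ‖V‖ ^ 2).trans_le (h V)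

lemma isVonNBounded_capBilin {a κ c : ℝ} (ha : 0 < a) (ha1 : a ≤ 1) (hc : 0 < c) (X : Plane) :
    Bornology.IsVonNBounded ℝ {V | capBilin a κ c X V V < 1} := by
  obtain ⟨m, hm, h⟩ := exists_mul_sq_norm_le_capBilin (κ := κ) ha ha1 hc X
  refine NormedSpace.isVonNBounded_of_isBounded ℝ
    ((Metric.isBounded_closedBall (x := (0 : Plane)) (r := 1 + 1 / m)).subset fun V hV => ?_)
  rw [mem_closedBall_zero_iff]
  have h2 : ‖V‖ ^ 2 < 1 / m := by
    rw [lt_div_iff₀' hm]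
    exact (h V).trans_lt hV
  nlinarith [norm_nonneg V, sq_nonneg (‖V‖ - 1)]

namespace ConeAtlas

variable {S : Type*} [MetricSpace S]

/-- The charts of the cone atlas are the preferred charts of the manifold. -/
def IsPreferred (A : ConeAtlas S) [ChartedSpace Plane S] : Prop :=
  ∀ x : S, chartAt Plane x = A.chart x

lemma sq_sinh_le_sq_norm (A : ConeAtlas S) {δ : ℝ} (hδ : 0 ≤ δ) {x z : S}
    (hz : z ∈ (A.chart x).source) (h : δ ≤ dist (A.center x) z) :
    Real.sinh δ ^ 2 ≤ ‖A.chart x z‖ ^ 2 := by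
  rw [(A.isHypChart x).norm_eq hz]
  exact pow_le_pow_left₀ (Real.sinh_nonneg_iff.2 hδ)
    (Real.sinh_le_sinh.2 h) 2

section

variable (A : ConeAtlas S) [ChartedSpace Plane S] [IsManifold 𝓘(ℝ, Plane) ∞ S]

lemma tangentCoordChange_eq (hA : A.IsPreferred) (x y z : S) :
    tangentCoordChange 𝓘(ℝ, Plane) x y z =
      fderiv ℝ (fun Y => A.chart y ((A.chart x).symm Y)) (A.chart x z) := by
  rw [tangentCoordChange_def]
  simp only [modelWithCornersSelf_coe, Set.range_id, fderivWithin_univ, extChartAt, hA x, hA y,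
    mfld_simps]
  rfl

/-- The smoothed metric does not depend on the chart: where two distinct charts overlap, it is a
multiple of the infinitesimal cone metric. -/
lemma capBilin_tangentCoordChange (hA : A.IsPreferred) {δ : ℝ} (hδ : 0 < δ) (hδA : δ ≤ A.gap)
    (c : ℝ) {x y z : S} (hx : z ∈ (A.chart x).source) (hy : z ∈ (A.chart y).source)
    (V W : Plane) :
    capBilin (A.angle y) (Real.sinh δ ^ 2) c (A.chart y z)
      (tangentCoordChange 𝓘(ℝ, Plane) x y z V) (tangentCoordChange 𝓘(ℝ, Plane) x y z W) =
    capBilin (A.angle x) (Real.sinh δ ^ 2) c (A.chart x z) V W := by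
  have hκ : 0 < Real.sinh δ ^ 2 := pow_pos (Real.sinh_pos_iff.2 hδ) 2
  rcases A.overlap x y z hx hy with ⟨h1, h2⟩ | ⟨h1, h2⟩
  · have h3 : tangentCoordChange 𝓘(ℝ, Plane) x y z = ContinuousLinearMap.id ℝ Plane := by
      rw [A.tangentCoordChange_eq hA, ← h1]
      have : (fun Y => A.chart x ((A.chart x).symm Y)) =ᶠ[𝓝 (A.chart x z)] id := by
        filter_upwards [(A.chart x).open_target.mem_nhds ((A.chart x).map_source hx)] with Y hY
        exact (A.chart x).right_inv hY
      rw [this.fderiv_eq, fderiv_id]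
    rw [h3, h1, h2]
    rfl
  · have hq : ∀ V, capBilin (A.angle y) (Real.sinh δ ^ 2) c (A.chart y z)
        (tangentCoordChange 𝓘(ℝ, Plane) x y z V) (tangentCoordChange 𝓘(ℝ, Plane) x y z V) =
        capBilin (A.angle x) (Real.sinh δ ^ 2) c (A.chart x z) V V := fun V => by
      rw [capBilin_self_eq c hκ (h2.imp_right fun h => A.sq_sinh_le_sq_norm hδ.le hy (hδA.trans h)),
        capBilin_self_eq c hκ (h1.imp_right fun h => A.sq_sinh_le_sq_norm hδ.le hx (hδA.trans h)),
        A.tangentCoordChange_eq hA, coneForm_transition (A.angle_pos x) (A.angle_le_one x)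
          (A.angle_pos y) (A.angle_le_one y) (A.isHypChart x) (A.isHypChart y) hx hy]
    -- polarization
    have h3 := hq (V + W)
    simp only [map_add, add_apply, hq] at h3
    rw [capBilin_symm _ _ _ _ W V, capBilin_symm _ _ _ _ (tangentCoordChange 𝓘(ℝ, Plane) x y z W)]
      at h3
    linarith

/-- The bilinear form of the smoothed metric on the tangent space at `x`, which is the model plane
of the chart around `x`. -/
def metricForm (κ c : ℝ) (x : S) :
    TangentSpace 𝓘(ℝ, Plane) x →L[ℝ] TangentSpace 𝓘(ℝ, Plane) x →L[ℝ] ℝ :=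
  capBilin (A.angle x) κ c (A.chart x x)

lemma contMDiff_metricForm (hA : A.IsPreferred) {δ c : ℝ} (hδ : 0 < δ) (hδA : δ ≤ A.gap) :
    ContMDiff 𝓘(ℝ, Plane) (𝓘(ℝ, Plane).prod 𝓘(ℝ, Plane →L[ℝ] Plane →L[ℝ] ℝ)) ∞
      (fun x : S => Bundle.TotalSpace.mk' (Plane →L[ℝ] Plane →L[ℝ] ℝ)
        (E := fun x : S => TangentSpace 𝓘(ℝ, Plane) x →L[ℝ] TangentSpace 𝓘(ℝ, Plane) x →L[ℝ] ℝ)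
        x (A.metricForm (Real.sinh δ ^ 2) c x)) := by
  intro x₀
  rw [Bundle.contMDiffAt_section]
  have hκ : 0 < Real.sinh δ ^ 2 := pow_pos (Real.sinh_pos_iff.2 hδ) 2
  have h1 : ContMDiffAt 𝓘(ℝ, Plane) 𝓘(ℝ, Plane →L[ℝ] Plane →L[ℝ] ℝ) ∞
      (fun z => capBilin (A.angle x₀) (Real.sinh δ ^ 2) c (A.chart x₀ z)) x₀ := by
    have h2 : ContMDiffAt 𝓘(ℝ, Plane) 𝓘(ℝ, Plane) ∞ (A.chart x₀) x₀ := by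
      have := contMDiffAt_extChartAt (I := 𝓘(ℝ, Plane)) (n := ∞) (x := x₀)
      simpa only [extChartAt, hA x₀, mfld_simps] using this
    exact (contDiff_capBilin (A.angle_pos x₀) (A.angle_le_one x₀) hκ c).contMDiff.contMDiffAt.comp
      x₀ h2
  refine h1.congr_of_eventuallyEq ?_
  filter_upwards [(A.chart x₀).open_source.mem_nhds (A.mem_source x₀)] with z hz
  have hz' : z ∈ (chartAt Plane x₀).source := by rwa [hA x₀]
  -- in the trivialization at `x₀`, the form at `z` is the one of the chart at `x₀`
  rw [hom_trivializationAt_apply]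
  ext V W
  rw [inCoordinates_apply_eq₂ (by simpa using hz') (by simpa using hz') (by simp)]
  have hs : ∀ V, (trivializationAt Plane (TangentSpace 𝓘(ℝ, Plane)) x₀).symm z V =
      tangentCoordChange 𝓘(ℝ, Plane) x₀ z z V := fun V => by
    have := TangentBundle.symmL_trivializationAt_eq_core (I := 𝓘(ℝ, Plane)) hz'
    exact (Bundle.Trivialization.symmL_apply (R := ℝ) _ (by simpa using hz') V).symm.trans
      (congrArg (fun L => L V) this)
  have hL : ∀ t : ℝ, (trivializationAt ℝ (fun _ : S => ℝ) x₀).linearMapAt ℝ z t = t := fun t => by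
    simp
  rw [hs, hs]
  refine (hL _).trans ?_
  exact A.capBilin_tangentCoordChange hA hδ hδA c hz (A.mem_source z) V W

/-- The smoothed metric, multiplied by `c`. Within distance `δ` from the singularities, the
cones are replaced by smooth caps. -/
def smoothMetric (hA : A.IsPreferred) {δ c : ℝ} (hδ : 0 < δ) (hδA : δ ≤ A.gap) (hc : 0 < c) :
    SmoothMetric S where
  inner := A.metricForm (Real.sinh δ ^ 2) c
  symm _ _ _ := capBilin_symm _ _ _ _ _ _
  pos x _ hV := capBilin_self_pos (A.angle_pos x) (A.angle_le_one x) hc _ hV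
  isVonNBounded x := isVonNBounded_capBilin (A.angle_pos x) (A.angle_le_one x) hc _
  contMDiff := A.contMDiff_metricForm hA hδ hδA

variable {A}

/-- The tangent space at a point is the model plane of the preferred chart there, so that the
derivative of the inverse of another chart is a coordinate change. -/
lemma mfderiv_chart_symm {x : S} {u : Plane} (hu : u ∈ (chartAt Plane x).target) :
    mfderiv 𝓘(ℝ, Plane) 𝓘(ℝ, Plane) (chartAt Plane x).symm u =
      tangentCoordChange 𝓘(ℝ, Plane) x ((chartAt Plane x).symm u) ((chartAt Plane x).symm u) := by
  have h1 : MDifferentiableAt 𝓘(ℝ, Plane) 𝓘(ℝ, Plane) (chartAt Plane x).symm u :=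
    mdifferentiableAt_atlas_symm (chart_mem_atlas Plane x) hu
  rw [h1.mfderiv, tangentCoordChange_def]
  simp only [writtenInExtChartAt, mfld_simps, (chartAt Plane x).right_inv hu]
  rfl

/-- The coordinate expression of the smoothed metric in a chart. -/
lemma inner_mfderiv_chart_symm (hA : A.IsPreferred) {δ c : ℝ} (hδ : 0 < δ) (hδA : δ ≤ A.gap)
    (hc : 0 < c) {x : S} {u : Plane} (hu : u ∈ (A.chart x).target) (V W : Plane) :
    (A.smoothMetric hA hδ hδA hc).inner ((A.chart x).symm u)
      (mfderiv 𝓘(ℝ, Plane) 𝓘(ℝ, Plane) (A.chart x).symm u V)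
      (mfderiv 𝓘(ℝ, Plane) 𝓘(ℝ, Plane) (A.chart x).symm u W) =
      capBilin (A.angle x) (Real.sinh δ ^ 2) c u V W := by
  have hz := (A.chart x).map_target hu
  have h := A.capBilin_tangentCoordChange hA hδ hδA c hz (A.mem_source _) V W
  rw [(A.chart x).right_inv hu] at h
  rw [← h, ← hA x, mfderiv_chart_symm (by rwa [hA x]), hA x]
  rfl

theorem neg_one_lt_curvature_smoothMetric (hA : A.IsPreferred) {δ c : ℝ} (hδ : 0 < δ)
    (hδA : δ ≤ A.gap) (hc : 1 < c) (x : S) :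
    -1 < (A.smoothMetric hA hδ hδA (zero_lt_one.trans hc)).curvature x := by
  refine neg_one_lt_planeCurvature_capBilin (A.angle_pos x) (A.angle_le_one x)
    (pow_pos (Real.sinh_pos_iff.2 hδ) 2) hc ?_
  rw [hA x]
  filter_upwards [(A.chart x).open_target.mem_nhds ((A.chart x).map_source (A.mem_source x))]
    with u hu i j
  exact inner_mfderiv_chart_symm hA hδ hδA (zero_lt_one.trans hc) hu _ _

end
end ConeAtlas

end

section

open scoped ENNReal

/-! ### Lengths and distances of smooth metrics -/

namespace SmoothMetric

variable {S : Type*} [TopologicalSpace S] [ChartedSpace Plane S] [IsManifold 𝓘(ℝ, Plane) ∞ S]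

/-- The Riemannian distance with values in `ℝ≥0∞`. -/
def eDistance (g : SmoothMetric S) (x y : S) : ℝ≥0∞ :=
  letI : Bundle.RiemannianBundle (fun z : S => TangentSpace 𝓘(ℝ, Plane) z) :=
    ⟨g.toRiemannianMetric⟩
  Manifold.riemannianEDist 𝓘(ℝ, Plane) x y

lemma distance_eq (g : SmoothMetric S) (x y : S) : g.distance x y = (g.eDistance x y).toReal := rfl

/-- The speed of a curve. -/
def speed (g : SmoothMetric S) (γ : ℝ → S) (t : ℝ) : ℝ :=
  √(g.inner (γ t) (mfderiv 𝓘(ℝ, ℝ) 𝓘(ℝ, Plane) γ t (1 : ℝ))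
    (mfderiv 𝓘(ℝ, ℝ) 𝓘(ℝ, Plane) γ t (1 : ℝ)))

lemma speed_eq (g : SmoothMetric S) (γ : ℝ → S) (t : ℝ) :
    letI : Bundle.RiemannianBundle (fun z : S => TangentSpace 𝓘(ℝ, Plane) z) :=
      ⟨g.toRiemannianMetric⟩
    ‖mfderiv 𝓘(ℝ, ℝ) 𝓘(ℝ, Plane) γ t (1 : ℝ)‖ = g.speed γ t := by
  let _ : Bundle.RiemannianBundle (fun z : S => TangentSpace 𝓘(ℝ, Plane) z) :=
    ⟨g.toRiemannianMetric⟩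
  rw [norm_eq_sqrt_real_inner]
  rfl

lemma eDistance_comm (g : SmoothMetric S) (x y : S) : g.eDistance x y = g.eDistance y x := by
  let _ : Bundle.RiemannianBundle (fun z : S => TangentSpace 𝓘(ℝ, Plane) z) :=
    ⟨g.toRiemannianMetric⟩
  exact Manifold.riemannianEDist_comm

lemma eDistance_triangle (g : SmoothMetric S) (x y z : S) :
    g.eDistance x z ≤ g.eDistance x y + g.eDistance y z := by
  let _ : Bundle.RiemannianBundle (fun z : S => TangentSpace 𝓘(ℝ, Plane) z) :=
    ⟨g.toRiemannianMetric⟩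
  exact Manifold.riemannianEDist_triangle

lemma eDistance_self (g : SmoothMetric S) (x : S) : g.eDistance x x = 0 := by
  let _ : Bundle.RiemannianBundle (fun z : S => TangentSpace 𝓘(ℝ, Plane) z) :=
    ⟨g.toRiemannianMetric⟩
  exact Manifold.riemannianEDist_self

lemma eDistance_le_of_speed_le (g : SmoothMetric S) {γ : ℝ → S} {C : ℝ}
    (hγ : ContMDiffOn 𝓘(ℝ, ℝ) 𝓘(ℝ, Plane) 1 γ (Set.Icc 0 1))
    (hC : ∀ t ∈ Set.Icc (0 : ℝ) 1, g.speed γ t ≤ C) :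
    g.eDistance (γ 0) (γ 1) ≤ ENNReal.ofReal C := by
  let _ : Bundle.RiemannianBundle (fun z : S => TangentSpace 𝓘(ℝ, Plane) z) :=
    ⟨g.toRiemannianMetric⟩
  refine (Manifold.riemannianEDist_le_pathELength hγ rfl rfl zero_le_one).trans ?_
  rw [Manifold.pathELength_eq_lintegral_mfderiv_Icc]
  refine (MeasureTheory.setLIntegral_mono (g := fun _ => ENNReal.ofReal C) measurable_const
    fun t ht => ?_).trans ?_
  · rw [← ofReal_norm]
    exact ENNReal.ofReal_le_ofReal ((g.speed_eq γ t).trans_le (hC t ht))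
  · simp

lemma continuous_speed (g : SmoothMetric S) {γ : ℝ → S}
    (hγ : ContMDiff 𝓘(ℝ, ℝ) 𝓘(ℝ, Plane) 1 γ) : Continuous (g.speed γ) := by
  let _ : Bundle.RiemannianBundle (fun z : S => TangentSpace 𝓘(ℝ, Plane) z) :=
    ⟨g.toRiemannianMetric⟩
  have h1 : Continuous fun t : ℝ => (⟨γ t, mfderiv 𝓘(ℝ, ℝ) 𝓘(ℝ, Plane) γ t (1 : ℝ)⟩ :
      TangentBundle 𝓘(ℝ, Plane) S) := by
    have h2 : Continuous fun t : ℝ => (⟨t, (1 : ℝ)⟩ : TangentBundle 𝓘(ℝ, ℝ) ℝ) := by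
      have := (tangentBundleModelSpaceHomeomorph 𝓘(ℝ, ℝ)).symm.continuous.comp
        (Continuous.prodMk_left (X := ℝ) (1 : ℝ))
      exact this
    exact (hγ.continuous_tangentMap le_rfl).comp h2
  have h2 : Continuous fun t : ℝ => g.inner (γ t) (mfderiv 𝓘(ℝ, ℝ) 𝓘(ℝ, Plane) γ t (1 : ℝ))
    (mfderiv 𝓘(ℝ, ℝ) 𝓘(ℝ, Plane) γ t (1 : ℝ)) := by
    have : IsContinuousRiemannianBundle Plane (fun z : S => TangentSpace 𝓘(ℝ, Plane) z) :=
      ⟨⟨g.inner, g.contMDiff.continuous, fun _ _ _ => rfl⟩⟩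
    exact h1.inner_bundle (F := Plane) (E := fun z : S => TangentSpace 𝓘(ℝ, Plane) z) h1
  exact h2.sqrt

lemma exists_integral_speed_lt (g : SmoothMetric S) {x y : S} {r : ℝ}
    (h : g.eDistance x y < ENNReal.ofReal r) :
    ∃ γ : ℝ → S, γ 0 = x ∧ γ 1 = y ∧ ContMDiff 𝓘(ℝ, ℝ) 𝓘(ℝ, Plane) 1 γ ∧
      ∫ t in (0 : ℝ)..1, g.speed γ t < r := by
  let _ : Bundle.RiemannianBundle (fun z : S => TangentSpace 𝓘(ℝ, Plane) z) :=
    ⟨g.toRiemannianMetric⟩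
  obtain ⟨γ, h0, h1, hγ, hlt, -⟩ :=
    Manifold.exists_lt_locally_constant_of_riemannianEDist_lt h zero_lt_one
  refine ⟨γ, h0, h1, hγ, ?_⟩
  have hc := g.continuous_speed hγ
  rw [Manifold.pathELength_eq_lintegral_mfderiv_Icc] at hlt
  have h2 : ∀ t, ‖mfderiv 𝓘(ℝ, ℝ) 𝓘(ℝ, Plane) γ t (1 : ℝ)‖ₑ = ENNReal.ofReal (g.speed γ t) :=
    fun t => by
      rw [← ofReal_norm]
      exact congrArg _ (g.speed_eq γ t)
  have h3 : ∫⁻ t in Set.Icc (0 : ℝ) 1, ENNReal.ofReal (g.speed γ t) < ENNReal.ofReal r := by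
    refine lt_of_eq_of_lt (MeasureTheory.lintegral_congr fun t => ?_) hlt
    exact (h2 t).symm
  rw [← MeasureTheory.ofReal_integral_eq_lintegral_ofReal (hc.integrableOn_Icc)
    (Eventually.of_forall fun t => Real.sqrt_nonneg _)] at h3
  rw [intervalIntegral.integral_of_le zero_le_one, ← MeasureTheory.integral_Icc_eq_integral_Ioc]
  exact (ENNReal.ofReal_lt_ofReal_iff_of_nonneg
    (MeasureTheory.integral_nonneg fun t => Real.sqrt_nonneg _)).1 h3

end SmoothMetric

/-! ### The upper bound -/

/-- A distance function that is at most `C` times the given distance for nearby points is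
at most `C` times the length of a curve between the points. -/
theorem le_mul_eVariationOn_of_eventually {S : Type*} [PseudoEMetricSpace S] {D : S → S → ℝ≥0∞}
    {C : ℝ≥0∞} (hself : ∀ x, D x x = 0) (hcomm : ∀ x y, D x y = D y x)
    (htri : ∀ x y z, D x z ≤ D x y + D y z) (hloc : ∀ x, ∀ᶠ y in 𝓝 x, D x y ≤ C * edist x y)
    {γ : ℝ → S} (hγ : Continuous γ) :
    D (γ 0) (γ 1) ≤ C * eVariationOn γ (Set.Icc 0 1) := by
  -- the supremum of the times up to which the inequality holds
  let s : Set ℝ := {t | t ∈ Set.Icc (0 : ℝ) 1 ∧ D (γ 0) (γ t) ≤ C * eVariationOn γ (Set.Icc 0 t)}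
  have h0 : (0 : ℝ) ∈ s := ⟨by simp, by simp [hself]⟩
  have hs1 : ∀ t ∈ s, t ≤ 1 := fun t ht => ht.1.2
  have hbdd : BddAbove s := ⟨1, hs1⟩
  set T := sSup s with hT
  have hT0 : 0 ≤ T := le_csSup hbdd h0
  have hT1 : T ≤ 1 := csSup_le ⟨0, h0⟩ hs1
  have hnear : ∀ᶠ t in 𝓝 T, D (γ T) (γ t) ≤ C * edist (γ T) (γ t) :=
    hγ.continuousAt.eventually (hloc (γ T))
  -- from a good time, one can proceed by steps for which the local inequality holds
  have hadd : ∀ a b, a ∈ s → a ≤ b → b ≤ 1 → D (γ a) (γ b) ≤ C * edist (γ a) (γ b) → b ∈ s := by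
    intro a b ha hab hb h
    refine ⟨⟨ha.1.1.trans hab, hb⟩, (htri _ (γ a) _).trans ((add_le_add ha.2 h).trans ?_)⟩
    have h1 := eVariationOn.Icc_add_Icc γ (s := Set.univ) ha.1.1 hab (Set.mem_univ a)
    simp only [Set.univ_inter] at h1
    rw [← mul_add, ← h1]
    gcongr
    exact eVariationOn.edist_le γ (Set.left_mem_Icc.2 hab) (Set.right_mem_Icc.2 hab)
  have hTs : T ∈ s := by
    obtain ⟨ε, hε, hball⟩ := Metric.eventually_nhds_iff.1 hnear
    obtain ⟨t, ht, htT⟩ := exists_lt_of_lt_csSup ⟨0, h0⟩ (show T - ε < sSup s by linarith)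
    have htT' : t ≤ T := le_csSup hbdd ht
    refine hadd t T ht htT' hT1 ?_
    rw [hcomm, edist_comm]
    exact hball (by rw [Real.dist_eq, abs_lt]; constructor <;> linarith)
  rcases hT1.eq_or_lt with h | h
  · rw [h] at hTs
    exact hTs.2
  · exfalso
    obtain ⟨ε, hε, hball⟩ := Metric.eventually_nhds_iff.1 hnear
    have h1 : T < min 1 (T + ε / 2) := lt_min h (by linarith)
    have h2 := hadd T _ hTs h1.le (min_le_left _ _) (hball (by
      rw [Real.dist_eq, abs_lt]
      constructor <;> linarith [min_le_right 1 (T + ε / 2)]))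
    exact absurd (le_csSup hbdd h2) (not_le.2 h1)

/-- In a length space, a local comparison of distances is a global one. -/
theorem IsHyperbolicPolyhedral.le_mul_dist_of_eventually {S : Type*} [MetricSpace S]
    (hS : IsHyperbolicPolyhedral S) {D : S → S → ℝ≥0∞} {C : ℝ} (hC : 0 ≤ C)
    (hself : ∀ x, D x x = 0) (hcomm : ∀ x y, D x y = D y x)
    (htri : ∀ x y z, D x z ≤ D x y + D y z)
    (hloc : ∀ x, ∀ᶠ y in 𝓝 x, D x y ≤ ENNReal.ofReal C * edist x y) (x y : S) :
    D x y ≤ ENNReal.ofReal (C * dist x y) := by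
  have h : ∀ ε : ℝ, 0 < ε → D x y ≤ ENNReal.ofReal (C * (dist x y + ε)) := by
    intro ε hε
    obtain ⟨γ, hγ⟩ := hS.exists_path x y ε hε
    have h1 := le_mul_eVariationOn_of_eventually hself hcomm htri hloc γ.continuous_extend
    rw [γ.extend_zero, γ.extend_one] at h1
    rw [ENNReal.ofReal_mul hC]
    refine h1.trans (mul_le_mul_right ?_ _)
    exact (eVariationOn.comp_le_of_monotoneOn γ (Set.projIcc 0 1 zero_le_one)
      ((Set.monotone_projIcc _).monotoneOn _) (Set.mapsTo_univ _ _)).trans hγ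
  have hlim : Tendsto (fun ε : ℝ => ENNReal.ofReal (C * (dist x y + ε))) (𝓝[>] 0)
      (𝓝 (ENNReal.ofReal (C * dist x y))) := by
    have : Continuous fun ε : ℝ => ENNReal.ofReal (C * (dist x y + ε)) :=
      ENNReal.continuous_ofReal.comp (by fun_prop)
    simpa using (this.tendsto 0).mono_left nhdsWithin_le_nhds
  exact ge_of_tendsto hlim (by filter_upwards [self_mem_nhdsWithin] with ε hε using h ε hε)

set_option synthInstance.maxHeartbeats 400000 in
/-- A positive definite form depending continuously on a parameter is nearly constant, in the
multiplicative sense. -/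
lemma eventually_apply_self_le {T F : Type*} [TopologicalSpace T] [NormedAddCommGroup F]
    [NormedSpace ℝ F] {G : T → F →L[ℝ] F →L[ℝ] ℝ} {x : T} (hG : ContinuousAt G x) {m M : ℝ}
    (hm : 0 < m) (hmV : ∀ V, m * ‖V‖ ^ 2 ≤ G x V V) (hM : 1 < M) :
    ∀ᶠ y in 𝓝 x, ∀ V, G y V V ≤ M * G x V V := by
  filter_upwards [hG.eventually
    (eventually_norm_sub_lt (G x) (mul_pos (sub_pos.2 hM) hm))] with y hy V
  have h2 := (le_abs_self _).trans ((G y - G x).le_opNorm₂ V V)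
  have h3 : (G y - G x) V V = G y V V - G x V V := rfl
  rw [h3] at h2
  have h4 := hmV V
  have h5 := mul_le_mul_of_nonneg_right hy.le (sq_nonneg ‖V‖)
  have h6 := mul_le_mul_of_nonneg_left h4 (show 0 ≤ M - 1 by linarith)
  linarith

namespace ConeAtlas

variable {S : Type*} [MetricSpace S] {A : ConeAtlas S} [ChartedSpace Plane S]
  [IsManifold 𝓘(ℝ, Plane) ∞ S]

/-- The speed of a curve that is a straight line in a chart. -/
lemma speed_smoothMetric_line (hA : A.IsPreferred) {δ c : ℝ} (hδ : 0 < δ) (hδA : δ ≤ A.gap)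
    (hc : 0 < c) (x : S) {X V : Plane} {t : ℝ} (ht : X + t • V ∈ (A.chart x).target) :
    (A.smoothMetric hA hδ hδA hc).speed (fun t => (A.chart x).symm (X + t • V)) t =
      √(capBilin (A.angle x) (Real.sinh δ ^ 2) c (X + t • V) V V) := by
  have h1 : HasMFDerivAt 𝓘(ℝ, ℝ) 𝓘(ℝ, Plane) (fun t : ℝ => X + t • V) t
      ((ContinuousLinearMap.id ℝ ℝ).smulRight V) :=
    HasFDerivAt.hasMFDerivAt (((hasFDerivAt_id t).smul_const V).const_add X)
  have h2 : MDifferentiableAt 𝓘(ℝ, Plane) 𝓘(ℝ, Plane) (A.chart x).symm (X + t • V) := by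
    rw [← hA x] at ht ⊢
    exact mdifferentiableAt_atlas_symm (chart_mem_atlas Plane x) ht
  have h3 := (h2.hasMFDerivAt.comp t h1).mfderiv
  rw [SmoothMetric.speed]
  have h4 : mfderiv 𝓘(ℝ, ℝ) 𝓘(ℝ, Plane) (fun t : ℝ => (A.chart x).symm (X + t • V)) t (1 : ℝ) =
      mfderiv 𝓘(ℝ, Plane) 𝓘(ℝ, Plane) (A.chart x).symm (X + t • V) V := by
    refine (congrArg (fun L => L (1 : ℝ)) h3).trans ?_
    exact congrArg (mfderiv 𝓘(ℝ, Plane) 𝓘(ℝ, Plane) (A.chart x).symm (X + t • V)) (one_smul ℝ V)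
  rw [h4]
  exact congrArg _ (inner_mfderiv_chart_symm hA hδ hδA hc ht V V)

/-- The image of a short segment in the chart is a nearly shortest path, and the smoothed metric is
at most `c` times the original one. -/
lemma eventually_eDistance_smoothMetric_le (hA : A.IsPreferred) {δ c K : ℝ} (hδ : 0 < δ)
    (hδA : δ ≤ A.gap) (hc : 0 < c) (hK : √c < K) (x : S) :
    ∀ᶠ y in 𝓝 x, (A.smoothMetric hA hδ hδA hc).eDistance x y ≤ ENNReal.ofReal K * edist x y := by
  have hκ : 0 < Real.sinh δ ^ 2 := pow_pos (Real.sinh_pos_iff.2 hδ) 2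
  have hsc : 0 < √c := Real.sqrt_pos.2 hc
  have hK0 : 0 < K := hsc.trans hK
  set κ := Real.sinh δ ^ 2
  set X := A.chart x x with hX
  -- a factor `M` is lost for each of the variation of the metric and the comparison of the segment
  -- with the distance
  set M := K / √c with hM
  have hM1 : 1 < M := (one_lt_div hsc).2 hK
  have hMc : M * (c * M) = K ^ 2 := by
    rw [hM]; field_simp; rw [Real.sq_sqrt hc.le]
  obtain ⟨m, hm, hmV⟩ := exists_mul_sq_norm_le_capBilin (κ := κ) (A.angle_pos x)
    (A.angle_le_one x) hc X
  have hx := A.mem_source x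
  -- near `X` the metric is nearly constant
  have h1 : ∀ᶠ Y in 𝓝 X, ∀ V, capBilin (A.angle x) κ c Y V V ≤
      M * capBilin (A.angle x) κ c X V V := by
    have hcont := (contDiff_capBilin (A.angle_pos x) (A.angle_le_one x) hκ c).continuous.tendsto X
    exact eventually_apply_self_le hcont hm hmV hM1
  obtain ⟨ρ, hρ, hball⟩ := Metric.eventually_nhds_iff_ball.1
    (h1.and ((A.chart x).open_target.mem_nhds ((A.chart x).map_source hx)))
  have h2 : ∀ᶠ Y in 𝓝 X, Y ∈ Metric.ball X ρ ∧
      coneForm (A.angle x) X (Y - X) ≤ M * hypDist (A.angle x) X Y ^ 2 :=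
    (show ∀ᶠ Y in 𝓝 X, Y ∈ Metric.ball X ρ from Metric.ball_mem_nhds X hρ).and
      (eventually_coneForm_le (A.angle_pos x) X hM1)
  filter_upwards [((A.chart x).continuousAt hx).eventually h2,
    (A.chart x).open_source.mem_nhds hx] with y hy hys
  obtain ⟨hy1, hy2⟩ := hy
  set Y := A.chart x y with hY
  have hline : ∀ t ∈ Set.Icc (0 : ℝ) 1, X + t • (Y - X) ∈ Metric.ball X ρ := fun t ht => by
    rw [mem_ball_iff_norm, add_sub_cancel_left, norm_smul, Real.norm_of_nonneg ht.1]
    exact (mul_le_of_le_one_left (norm_nonneg _) ht.2).trans_lt (mem_ball_iff_norm.1 hy1)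
  have hsm : ContMDiffOn 𝓘(ℝ, ℝ) 𝓘(ℝ, Plane) 1
      (fun t : ℝ => (A.chart x).symm (X + t • (Y - X))) (Set.Icc 0 1) := by
    have h3 : ContMDiffOn 𝓘(ℝ, Plane) 𝓘(ℝ, Plane) 1 (A.chart x).symm (A.chart x).target := by
      rw [← hA x]
      exact (contMDiffOn_chart_symm (n := ∞)).of_le (by simp)
    refine h3.comp (t := (A.chart x).target) (ContMDiff.contMDiffOn (ContDiff.contMDiff ?_))
      fun t ht => (hball _ (hline t ht)).2
    fun_prop
  have h4 := (A.smoothMetric hA hδ hδA hc).eDistance_le_of_speed_le hsm (C := K * dist x y) (by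
    intro t ht
    have h5 := hball _ (hline t ht)
    rw [speed_smoothMetric_line hA hδ hδA hc x h5.2]
    refine Real.sqrt_le_iff.2 ⟨by positivity, (h5.1 _).trans ?_⟩
    have h6 := capBilin_self_le (κ := κ) (A.angle_pos x) (A.angle_le_one x) hc.le X (Y - X)
    have h7 : dist x y = hypDist (A.angle x) X Y := (A.isHypChart x).dist_eq_of_mem hx hys
    rw [mul_pow, ← hMc, h7, mul_assoc, mul_assoc]
    refine mul_le_mul_of_nonneg_left (h6.trans ?_) (by linarith)
    exact mul_le_mul_of_nonneg_left hy2 hc.le)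
  simp only [zero_smul, add_zero, one_smul, add_sub_cancel] at h4
  rw [(A.chart x).left_inv hx, (A.chart x).left_inv hys] at h4
  rwa [edist_dist, ← ENNReal.ofReal_mul hK0.le]

theorem eDistance_smoothMetric_le (hS : IsHyperbolicPolyhedral S) (hA : A.IsPreferred) {δ c K : ℝ}
    (hδ : 0 < δ) (hδA : δ ≤ A.gap) (hc : 0 < c) (hK : √c < K) (x y : S) :
    (A.smoothMetric hA hδ hδA hc).eDistance x y ≤ ENNReal.ofReal (K * dist x y) :=
  hS.le_mul_dist_of_eventually ((Real.sqrt_nonneg c).trans hK.le) (SmoothMetric.eDistance_self _)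
    (SmoothMetric.eDistance_comm _) (SmoothMetric.eDistance_triangle _)
    (eventually_eDistance_smoothMetric_le hA hδ hδA hc hK) x y

end ConeAtlas

end

section

/-! ### The lower bound -/

namespace ConeAtlas

variable {S : Type*} [MetricSpace S]

/-- A bound for the distance from `x₀` to `y`, with error `δ` and, if the centre of the chart around
`z` is a singularity, by way of this singularity, with the ball of radius `δ` about it contracted to
a point. -/
def flatDistAux (A : ConeAtlas S) (k δ : ℝ) (x₀ z y : S) : ℝ :=
  if A.angle z < 1 then min (dist x₀ y + δ)
    (dist x₀ (A.center z) + k * max 0 (dist (A.center z) y - δ))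
  else dist x₀ y + δ

/-- A modification of the distance from `x₀` that is constant on the ball of radius `δ` about each
singularity, if `k` is sufficiently large (`flatDist_eq`). It is `k`-Lipschitz for the original
metric (`flatDist_le_add`). It is so for the smoothed one as well, which can be smaller than the
original one only where the function is constant. -/
def flatDist (A : ConeAtlas S) (k δ : ℝ) (x₀ y : S) : ℝ := ⨅ z, A.flatDistAux k δ x₀ z y

variable {A : ConeAtlas S} {k δ : ℝ}

lemma dist_sub_le_flatDistAux (hk : 1 ≤ k) (hδ : 0 ≤ δ) (x₀ z y : S) :
    dist x₀ y - δ ≤ A.flatDistAux k δ x₀ z y := by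
  rw [flatDistAux]
  split_ifs
  · refine le_min (by linarith) ?_
    have h1 := dist_triangle x₀ (A.center z) y
    have h2 := le_max_right 0 (dist (A.center z) y - δ)
    have h3 := le_mul_of_one_le_left (le_max_left 0 (dist (A.center z) y - δ)) hk
    linarith
  · linarith

lemma bddBelow_flatDistAux (hk : 1 ≤ k) (hδ : 0 ≤ δ) (x₀ y : S) :
    BddBelow (Set.range fun z => A.flatDistAux k δ x₀ z y) :=
  ⟨dist x₀ y - δ, by rintro _ ⟨z, rfl⟩; exact dist_sub_le_flatDistAux hk hδ x₀ z y⟩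

lemma dist_sub_le_flatDist (hk : 1 ≤ k) (hδ : 0 ≤ δ) (x₀ y : S) :
    dist x₀ y - δ ≤ A.flatDist k δ x₀ y :=
  have : Nonempty S := ⟨x₀⟩
  le_ciInf fun z => dist_sub_le_flatDistAux hk hδ x₀ z y

lemma flatDist_self_le (hk : 1 ≤ k) (hδ : 0 ≤ δ) (x₀ : S) : A.flatDist k δ x₀ x₀ ≤ δ := by
  refine (ciInf_le (bddBelow_flatDistAux hk hδ x₀ x₀) x₀).trans ?_
  rw [flatDistAux]
  split_ifs
  · exact (min_le_left _ _).trans (by simp)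
  · simp

lemma flatDist_le_add (hk : 1 ≤ k) (hδ : 0 ≤ δ) (x₀ y y' : S) :
    A.flatDist k δ x₀ y ≤ A.flatDist k δ x₀ y' + k * dist y y' := by
  have : Nonempty S := ⟨x₀⟩
  rw [← sub_le_iff_le_add]
  refine le_ciInf fun z => ?_
  rw [sub_le_iff_le_add]
  refine (ciInf_le (bddBelow_flatDistAux hk hδ x₀ y) z).trans ?_
  have h0 : dist y y' ≤ k * dist y y' := le_mul_of_one_le_left dist_nonneg hk
  have h1 := dist_triangle_right x₀ y y'
  simp only [flatDistAux]
  split_ifs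
  · rw [← min_add_add_right]
    refine min_le_min (by linarith) ?_
    have h2 : max 0 (dist (A.center z) y - δ) ≤
        max 0 (dist (A.center z) y' - δ) + dist y y' := by
      refine max_le (by positivity) ?_
      have h3 := dist_triangle_right (A.center z) y y'
      linarith [le_max_right 0 (dist (A.center z) y' - δ)]
    nlinarith [mul_le_mul_of_nonneg_left h2 (zero_le_one.trans hk)]
  · linarith

/-- The assumption on `k` makes `flatDist` large enough near the other singularities, whose distance
is at least `gap`. -/
lemma flatDist_eq (hk : 1 ≤ k) (hδ : 0 ≤ δ) (hkδ : 2 * k * δ ≤ (k - 1) * A.gap) {x₀ x y : S}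
    (hx : A.angle x < 1) (hy : dist (A.center x) y ≤ δ) :
    A.flatDist k δ x₀ y = dist x₀ (A.center x) := by
  have : Nonempty S := ⟨x₀⟩
  refine le_antisymm ((ciInf_le (bddBelow_flatDistAux hk hδ x₀ y) x).trans ?_)
    (le_ciInf fun z => ?_)
  · rw [flatDistAux, if_pos hx]
    refine (min_le_right _ _).trans ?_
    rw [max_eq_left (by linarith), mul_zero, add_zero]
  · have h1 : dist x₀ (A.center x) ≤ dist x₀ y + δ := by
      linarith [dist_triangle_right x₀ (A.center x) y]
    rw [flatDistAux]
    split_ifs with hz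
    · refine le_min h1 ?_
      have h5 := le_max_left 0 (dist (A.center z) y - δ)
      rcases eq_or_ne (A.center z) (A.center x) with h | h
      · rw [h] at h5 ⊢
        have : 0 ≤ k := zero_le_one.trans hk
        exact le_add_of_nonneg_right (mul_nonneg this h5)
      · have h2 := A.gap_le_dist z x hz hx h
        have h3 := dist_triangle_right (A.center z) (A.center x) y
        have h4 := mul_le_mul_of_nonneg_left (le_max_right 0 (dist (A.center z) y - δ))
          (zero_le_one.trans hk)
        have h6 := mul_le_mul_of_nonneg_left h2 (sub_nonneg.2 hk)
        have h7 := dist_triangle x₀ (A.center z) (A.center x)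
        have h8 := mul_le_mul_of_nonneg_left (show dist (A.center z) (A.center x) - 2 * δ ≤
          dist (A.center z) y - δ by linarith) (zero_le_one.trans hk)
        linarith
    · exact h1

variable [ChartedSpace Plane S]

/-- The velocity vector of a curve at time `t` is its derivative in the preferred chart at the point
`γ t`. -/
lemma hasDerivAt_chart_comp (hA : A.IsPreferred) {γ : ℝ → S} {t : ℝ}
    (hγ : MDifferentiableAt 𝓘(ℝ, ℝ) 𝓘(ℝ, Plane) γ t) :
    HasDerivAt (fun s => A.chart (γ t) (γ s))
      (mfderiv 𝓘(ℝ, ℝ) 𝓘(ℝ, Plane) γ t (1 : ℝ) : Plane) t := by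
  have h := hγ.hasMFDerivAt.2
  simp only [writtenInExtChartAt, extChartAt, mfld_simps, hA (γ t)] at h
  let D : ℝ →L[ℝ] Plane := mfderiv 𝓘(ℝ, ℝ) 𝓘(ℝ, Plane) γ t
  have h' : HasFDerivWithinAt (fun s => A.chart (γ t) (γ s)) D Set.univ t := h
  exact (hasFDerivWithinAt_univ.1 h').hasDerivAt

variable [IsManifold 𝓘(ℝ, Plane) ∞ S]

/-- Away from the balls of radius `δ` about the singularities, the metric is at least the original
one; on these balls, `flatDist` is constant. -/
lemma eventually_slope_flatDist_lt (hA : A.IsPreferred) {c : ℝ} (hδ : 0 < δ) (hδA : δ ≤ A.gap)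
    (hc : 1 ≤ c) (hk : 1 ≤ k) (hkδ : 2 * k * δ ≤ (k - 1) * A.gap) (x₀ : S) {γ : ℝ → S} {t : ℝ}
    (hγ : MDifferentiableAt 𝓘(ℝ, ℝ) 𝓘(ℝ, Plane) γ t) {r : ℝ}
    (hr : k * (A.smoothMetric hA hδ hδA (zero_lt_one.trans_le hc)).speed γ t < r) :
    ∀ᶠ s in 𝓝[>] t, slope (fun t => A.flatDist k δ x₀ (γ t)) t s < r := by
  have hk0 : 0 < k := zero_lt_one.trans_le hk
  have hκ : 0 < Real.sinh δ ^ 2 := pow_pos (Real.sinh_pos_iff.2 hδ) 2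
  set g := A.smoothMetric hA hδ hδA (zero_lt_one.trans_le hc)
  have hs0 : 0 ≤ g.speed γ t := Real.sqrt_nonneg _
  have hr0 : 0 < r := (mul_nonneg hk0.le hs0).trans_lt hr
  set x := γ t with hx
  have hcont : ContinuousAt γ t := hγ.continuousAt
  by_cases h : A.angle x = 1 ∨ δ ≤ dist (A.center x) x
  · set V : Plane := mfderiv 𝓘(ℝ, ℝ) 𝓘(ℝ, Plane) γ t (1 : ℝ) with hV
    have hspeed : coneForm (A.angle x) (A.chart x x) V ≤ g.speed γ t ^ 2 := by
      have h0 : g.inner (γ t) V V =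
        capBilin (A.angle x) (Real.sinh δ ^ 2) c (A.chart x x) V V := rfl
      have h1 := capBilin_self_eq c hκ
        (h.imp_right fun h => A.sq_sinh_le_sq_norm hδ.le (A.mem_source x) h) V
      obtain ⟨m, hm, hmV⟩ := exists_mul_sq_norm_le_coneForm (A.angle_pos x) (A.chart x x)
      have h2 : 0 ≤ coneForm (A.angle x) (A.chart x x) V := le_trans (by positivity) (hmV V)
      have h3 : g.speed γ t = √(g.inner (γ t) V V) := rfl
      rw [h3, h0, h1, Real.sq_sqrt (by positivity)]
      exact le_mul_of_one_le_left h2 hc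
    have hlim := (tendsto_hypDist_sq_div (a := A.angle x) (hasDerivAt_chart_comp hA hγ)
      (X := A.chart x x) rfl).mono_left (nhdsWithin_mono t fun s (hs : t < s) => hs.ne')
    have hlt : coneForm (A.angle x) (A.chart x x) V < (r / k) ^ 2 :=
      hspeed.trans_lt (pow_lt_pow_left₀ (by rwa [lt_div_iff₀' hk0]) hs0 two_ne_zero)
    filter_upwards [hlim.eventually (gt_mem_nhds hlt), self_mem_nhdsWithin,
      (hcont.eventually ((A.chart x).open_source.mem_nhds (A.mem_source x))).filter_mono
        nhdsWithin_le_nhds] with s hs hts hsx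
    have hts' : 0 < s - t := sub_pos.2 hts
    rw [← (A.isHypChart x).dist_eq_of_mem (A.mem_source x) hsx, ← div_pow] at hs
    have h4 := lt_of_pow_lt_pow_left₀ 2 (by positivity) hs
    rw [div_lt_div_iff₀ hts' hk0] at h4
    have h5 := flatDist_le_add (A := A) hk hδ.le x₀ (γ s) x
    rw [slope_def_field, div_lt_iff₀ hts']
    rw [dist_comm] at h5
    change A.flatDist k δ x₀ (γ s) - A.flatDist k δ x₀ x < _
    linarith
  · rw [not_or, not_le] at h
    have ha : A.angle x < 1 := lt_of_le_of_ne (A.angle_le_one x) h.1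
    have hnear : ∀ᶠ s in 𝓝 t, dist (A.center x) (γ s) < δ :=
      (continuousAt_const.dist hcont).eventually (gt_mem_nhds h.2)
    filter_upwards [hnear.filter_mono nhdsWithin_le_nhds] with s hs
    rw [slope_def_field]
    rw [flatDist_eq hk hδ.le hkδ ha hs.le, ← hx, flatDist_eq hk hδ.le hkδ ha h.2.le, sub_self,
      zero_div]
    exact hr0

/-- The original distance is hardly larger than the smoothed one: along a curve, `flatDist` grows at
most by `k` times the length. -/
theorem dist_le_mul_of_eDistance_lt (hA : A.IsPreferred) {c : ℝ} (hδ : 0 < δ) (hδA : δ ≤ A.gap)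
    (hc : 1 ≤ c) (hk : 1 ≤ k) (hkδ : 2 * k * δ ≤ (k - 1) * A.gap) {x y : S} {r : ℝ}
    (h : (A.smoothMetric hA hδ hδA (zero_lt_one.trans_le hc)).eDistance x y < ENNReal.ofReal r) :
    dist x y ≤ k * r + 2 * δ := by
  obtain ⟨γ, h0, h1, hγ, hlt⟩ := SmoothMetric.exists_integral_speed_lt _ h
  set g := A.smoothMetric hA hδ hδA (zero_lt_one.trans_le hc)
  have hcs := g.continuous_speed hγ
  have hcont : Continuous fun t => A.flatDist k δ x (γ t) := by
    refine (LipschitzWith.of_le_add_mul (f := A.flatDist k δ x) (Real.toNNReal k)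
      fun y z => ?_).continuous.comp hγ.continuous
    rw [Real.coe_toNNReal _ (zero_le_one.trans hk)]
    exact flatDist_le_add hk hδ.le x y z
  have hB : ∀ t, HasDerivAt (fun t => A.flatDist k δ x (γ 0) + k * ∫ s in (0 : ℝ)..t, g.speed γ s)
      (k * g.speed γ t) t := fun t =>
    ((intervalIntegral.integral_hasDerivAt_right (hcs.intervalIntegrable _ _)
      (hcs.stronglyMeasurableAtFilter _ _) hcs.continuousAt).const_mul k).const_add _
  have h2 := image_le_of_liminf_slope_right_le_deriv_boundary hcont.continuousOn (a := 0) (b := 1)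
    (by simp) (fun t _ => (hB t).continuousAt.continuousWithinAt)
    (fun t _ => (hB t).hasDerivWithinAt)
    (fun t _ r hr => (eventually_slope_flatDist_lt hA hδ hδA hc hk hkδ x
      (hγ.mdifferentiable one_ne_zero t) hr).frequently) (Set.right_mem_Icc.2 zero_le_one)
  simp only [h0, h1] at h2
  have h3 := flatDist_self_le (A := A) hk hδ.le x
  have h4 := dist_sub_le_flatDist (A := A) hk hδ.le x y
  have h5 := mul_le_mul_of_nonneg_left hlt.le (zero_le_one.trans hk)
  linarith

end ConeAtlas

end

section

/-! ### Convergence of the distances -/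

namespace ConeAtlas

variable {S : Type*} [MetricSpace S] {A : ConeAtlas S} [ChartedSpace Plane S]
  [IsManifold 𝓘(ℝ, Plane) ∞ S]

/-- For small `τ`, smoothing within distance `δ ≤ τ` from the singularities and scaling the metric
by `1 + τ` changes distances by at most `τ` times a constant depending on the diameter. -/
theorem exists_smoothMetric_abs_sub_lt [CompactSpace S] (hS : IsHyperbolicPolyhedral S)
    (hA : A.IsPreferred) {η : ℝ} (hη : 0 < η) :
    ∃ g : SmoothMetric S, (∀ x, -1 < g.curvature x) ∧
      ∀ x y, |g.distance x y - dist x y| < η := by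
  obtain ⟨R, hR0, hR⟩ : ∃ R : ℝ, 0 ≤ R ∧ ∀ x y : S, dist x y ≤ R :=
    ⟨Metric.diam (Set.univ : Set S), Metric.diam_nonneg, fun x y =>
      Metric.dist_le_diam_of_mem isCompact_univ.isBounded trivial trivial⟩
  have hgap := A.gap_pos
  -- distances change at most by `τ * (2 * R + 2)`
  set τ := min 1 (η / (4 * R + 4)) with hτ
  have hτ0 : 0 < τ := by positivity
  have hτ1 : τ ≤ 1 := min_le_left _ _
  have hτη : τ * (4 * R + 4) ≤ η := (le_div_iff₀ (by positivity)).1 (min_le_right _ _)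
  -- the bound on `δ` is the condition of `flatDist_eq` for `k = 1 + τ ≤ 2`
  set δ := min τ (τ * A.gap / 4) with hδ
  have hδ0 : 0 < δ := by positivity
  have hδτ : δ ≤ τ := min_le_left _ _
  have hδg : δ ≤ τ * A.gap / 4 := min_le_right _ _
  have hδA : δ ≤ A.gap := by nlinarith
  have hc : 1 < 1 + τ := by linarith
  have hK : √(1 + τ) < 1 + τ := by
    rw [Real.sqrt_lt' (by linarith)]
    nlinarith
  refine ⟨A.smoothMetric hA hδ0 hδA (zero_lt_one.trans hc),
    neg_one_lt_curvature_smoothMetric hA hδ0 hδA hc, fun x y => ?_⟩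
  set g := A.smoothMetric hA hδ0 hδA (zero_lt_one.trans hc) with hg
  have hup := eDistance_smoothMetric_le hS hA hδ0 hδA (zero_lt_one.trans hc) hK x y
  have hfin : g.eDistance x y ≠ ⊤ := ne_top_of_le_ne_top ENNReal.ofReal_ne_top hup
  have hup' : g.distance x y ≤ (1 + τ) * dist x y :=
    ENNReal.toReal_le_of_le_ofReal (by positivity) hup
  have hd0 : 0 ≤ g.distance x y := ENNReal.toReal_nonneg
  have hlow : dist x y ≤ (1 + τ) * g.distance x y + 2 * δ := by
    refine le_of_forall_pos_le_add fun ε hε => ?_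
    have h1 : g.eDistance x y < ENNReal.ofReal (g.distance x y + ε / (1 + τ)) := by
      rw [ENNReal.lt_ofReal_iff_toReal_lt hfin, ← SmoothMetric.distance_eq]
      exact lt_add_of_pos_right _ (by positivity)
    have h2 := dist_le_mul_of_eDistance_lt hA hδ0 hδA hc.le hc.le (by nlinarith) h1
    rw [mul_add, mul_div_cancel₀ _ (by positivity)] at h2
    linarith
  have hRxy := hR x y
  have h3 := mul_le_mul_of_nonneg_left hRxy hτ0.le
  have h4 : τ * g.distance x y ≤ τ * (2 * R) := by
    refine mul_le_mul_of_nonneg_left (hup'.trans ?_) hτ0.le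
    nlinarith [dist_nonneg (x := x) (y := y)]
  have h5 := mul_nonneg hτ0.le hR0
  rw [abs_lt]
  constructor <;> linarith

end ConeAtlas

end

end

theorem mainTheorem6 (S : Type*) [MetricSpace S] [CompactSpace S] [ConnectedSpace S]
    (hS : IsHyperbolicPolyhedral S) :
    ∃ (_ : ChartedSpace Plane S) (_ : IsManifold 𝓘(ℝ, Plane) ∞ S),
      (∀ (θ : ℝ) (p : S) (r : ℝ) (φ : OpenPartialHomeomorph S Plane),
        0 < θ → θ ≤ 2 * Real.pi → 0 < r → IsConeChart θ p r φ →
          φ ∈ IsManifold.maximalAtlas 𝓘(ℝ, Plane) ∞ S) ∧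
      ∃ h : ℕ → SmoothMetric S,
        (∀ n x, -1 < (h n).curvature x) ∧
        ∀ ε : ℝ, 0 < ε → ∃ N : ℕ, ∀ n ≥ N, ∀ x y : S,
          |(h n).distance x y - dist x y| < ε := by
  obtain ⟨A⟩ := hS.nonempty_coneAtlas
  refine ⟨A.chartedSpace, A.isManifold,
    fun θ p r φ hθ hθ' _ hφ => A.mem_maximalAtlas hθ hθ' hφ, ?_⟩
  let _ := A.chartedSpace
  have := A.isManifold
  have hA : A.IsPreferred := fun _ => rfl
  choose h hcurv hdist using fun n : ℕ =>
    ConeAtlas.exists_smoothMetric_abs_sub_lt hS hA (Nat.one_div_pos_of_nat (α := ℝ) (n := n))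
  refine ⟨h, hcurv, fun ε hε => ?_⟩
  obtain ⟨N, hN⟩ := exists_nat_one_div_lt hε
  exact ⟨N, fun n hn x y => (hdist n x y).trans_le ((Nat.one_div_le_one_div hn).trans hN.le)⟩
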